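/- **Theorem (copies of $P_3$).** All graphs are finite and simple. Let $P_m$ denote the path with $m$ edges (so $m+1$ vertices), let $\mathcal N(H,G)$ be the number of (not necessarily induced) copies of $H$ in $G$, i.e. the number of subgraphs of $G$ isomorphic to $H$, and let $\mathrm{ex}(n,H,F)$ be the maximum of $\mathcal N(H,G)$ over all $n$-vertex graphs $G$ that contain no (not necessarily induced) copy of $F$. For integers $n,k,a$ with $2a\le k\le n+a$, let $G_{n,k,a}$ be the $n$-vertex graph whose vertex set is partitioned into classes $A,B,C$ with $|A|=a$, $|B|=n-k+a$, $|C|=k-2a$, such that $A\cup C$ induces a clique, $B$ is an independent set, all edges between $A$ and $B$ are present, and there are no edges between $B$ and $C$. Let $k\ge 5$ be an integer and $t=\lfloor (k-1)/2\rfloor$. There exists $n_1\in\mathbb N$ (depending on $k$) such that for all $n\ge n_1$, $$\mathrm{ex}(n,P_3,P_k)=\mathcal N(P_3,G_{n,k,t}),$$ and, up to isomorphism, $G_{n,k,t}$ is the only $n$-vertex graph containing no copy of $P_k$ that has $\mathrm{ex}(n,P_3,P_k)$ copies of $P_3$. Moreover, for fixed $k$, as $n\to\infty$, $$\mathrm{ex}(n,P_3,P_k)=\frac{3t(t-1)}{2}\,n^2+O(n).$$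 -/

import Mathlib

/-!
Write `k = 2t + 1` or `k = 2t + 2` and count copies of `P_3` as paths on four vertices. In
`G_{n,k,t}` almost all of them alternate between the `t` vertices of `A` and the rest, in one of
the patterns `BAAB`, `BABA`, `ABAB`, and there are `3t(t - 1)n²/2 + O(n)`.

Let `G` be `P_k`-free with at least as many. The number of edges is linear in `n`, so few vertices
have large degree, and nearly all four-vertex paths are governed by how many neighbours the other
vertices, and pairs of them, have in the set `L` of vertices of large degree. A component of
low-degree vertices which sees `j` vertices of `L` is sparse, because a long path in it could be
continued through `L`; weighing its edges against the missing neighbours in `L` shows that most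
pairs must have the same `t` neighbours in `L`. This gives a set `A` of `t` hubs adjacent to all
but a small fraction of the vertices. Paths outside `A` are now short, because they can be
prolonged through the hubs, and hence if more than `k - 2t` vertices outside `A` have a neighbour
outside `A`, then replacing `G` by the graph of all pairs meeting `A` increases the number of
four-vertex paths. Otherwise `G` embeds into `G_{n,k,t}`, and it equals it because every edge of
`G_{n,k,t}` lies on a four-vertex path.
-/

open Filter Asymptotics

namespace GenTuran

/-- The path `P_m` of length `m`, that is, with `m` edges and `m + 1` vertices. -/
abbrev pathOfLength (m : ℕ) : SimpleGraph (Fin (m + 1)) := SimpleGraph.pathGraph (m + 1)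

open Classical in
/-- `ex(n, H, F)`: the maximum number of (not necessarily induced, unlabelled) copies of `H`
in an `n`-vertex graph containing no (not necessarily induced) copy of `F`. -/
noncomputable def ex (n : ℕ) {W W' : Type*} (H : SimpleGraph W) (F : SimpleGraph W') : ℕ :=
  (Finset.univ.filter fun G : SimpleGraph (Fin n) => F.Free G).sup fun G => G.copyCount H

/-- `G` is extremal for `ex(n, H, F)`: it is `F`-free and it has the maximum number of
copies of `H`. -/
def IsExtremalFor {n : ℕ} {W W' : Type*} (G : SimpleGraph (Fin n))
    (H : SimpleGraph W) (F : SimpleGraph W') : Prop :=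
  F.Free G ∧ G.copyCount H = ex n H F

/-- The graph `G_{n,k,a}` (for `2 * a ≤ k` and `k ≤ n + a`). The vertex set `{0, …, n - 1}` is
split into `A = {i | i < a}`, `C = {i | a ≤ i < k - a}` and `B = {i | k - a ≤ i}`, of sizes
`a`, `k - 2a` and `n - k + a`. The set `A ∪ C = {i | i < k - a}` is a clique, `B` is independent,
all edges between `A` and `B` are present, and there are no edges between `B` and `C`. -/
def extGraph (n k a : ℕ) : SimpleGraph (Fin n) where
  Adj i j := i ≠ j ∧ ((i.val < k - a ∧ j.val < k - a) ∨ i.val < a ∨ j.val < a)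
  symm := ⟨fun i j h => by
    obtain ⟨h₁, h₂⟩ := h
    exact ⟨h₁.symm, by tauto⟩⟩
  loopless := ⟨fun i h => h.1 rfl⟩

end GenTuran

namespace GenTuran

open Finset

section Paths

variable {V : Type*} {G : SimpleGraph V}

/-- `l` is the sequence of vertices of a path in `G`. A list is preferred to a `SimpleGraph.Walk`
because the end vertices change whenever paths are cut and glued. -/
structure IsPathList (G : SimpleGraph V) (l : List V) : Prop where
  isChain : l.IsChain G.Adj
  nodup : l.Nodup

/-- Every path of `G` has fewer than `m` vertices. -/
def NoPath (G : SimpleGraph V) (m : ℕ) : Prop := ∀ l, IsPathList G l → l.length < m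

theorem NoPath.mono {m m' : ℕ} (h : NoPath G m) (hm : m ≤ m') : NoPath G m' :=
  fun l hl => (h l hl).trans_le hm

theorem isPathList_singleton (x : V) : IsPathList G [x] := ⟨by simp, by simp⟩

theorem isPathList_pair {x y : V} (h : G.Adj x y) : IsPathList G [x, y] :=
  ⟨by simpa using h, by simpa using h.ne⟩

theorem IsPathList.cons {a b : V} {l : List V} (h : IsPathList G (b :: l)) (hab : G.Adj a b)
    (ha : a ∉ b :: l) : IsPathList G (a :: b :: l) :=
  ⟨List.isChain_cons_cons.2 ⟨hab, h.isChain⟩, List.nodup_cons.2 ⟨ha, h.nodup⟩⟩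

theorem IsPathList.of_isInfix {l l' : List V} (h : IsPathList G l) (hl : l' <:+: l) :
    IsPathList G l' := by
  refine ⟨?_, h.nodup.sublist hl.sublist⟩
  obtain ⟨s, t, rfl⟩ := hl
  exact h.isChain.left_of_append.right_of_append

theorem IsPathList.reverse {l : List V} (h : IsPathList G l) : IsPathList G l.reverse :=
  ⟨List.isChain_reverse.2 (h.isChain.imp fun _ _ hab => hab.symm), List.nodup_reverse.2 h.nodup⟩

theorem IsPathList.append {l l' : List V} (h : IsPathList G l) (h' : IsPathList G l')
    (hadj : ∀ x ∈ l.getLast?, ∀ y ∈ l'.head?, G.Adj x y) (hdisj : l.Disjoint l') :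
    IsPathList G (l ++ l') :=
  ⟨List.isChain_append.2 ⟨h.isChain, h'.isChain, hadj⟩,
    List.nodup_append'.2 ⟨h.nodup, h'.nodup, hdisj⟩⟩

theorem isPathList_ofFn {m : ℕ} (f : SimpleGraph.Copy (pathOfLength m) G) :
    IsPathList G (List.ofFn f) := by
  refine ⟨List.isChain_iff_getElem.2 fun i hi => ?_, List.nodup_ofFn.2 f.injective⟩
  simp only [List.getElem_ofFn]
  exact f.toHom.map_adj (SimpleGraph.pathGraph_adj.2 (by simp))

theorem IsPathList.exists_copy {l : List V} {m : ℕ} (hl : IsPathList G l)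
    (hlen : l.length = m + 1) :
    ∃ f : SimpleGraph.Copy (pathOfLength m) G, List.ofFn f = l := by
  have hstep : ∀ i j : Fin (m + 1), i.val + 1 = j.val →
      G.Adj (l.get (i.cast hlen.symm)) (l.get (j.cast hlen.symm)) := fun i j hij => by
    simpa [hij] using List.isChain_iff_getElem.1 hl.isChain i (by lia)
  refine ⟨⟨⟨fun i => l.get (i.cast hlen.symm), fun {i j} hij => ?_⟩, fun i j hij => ?_⟩, ?_⟩
  · exact (SimpleGraph.pathGraph_adj.1 hij).elim (hstep i j) fun h => (hstep j i h).symm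
  · simpa [Fin.ext_iff] using (List.Nodup.get_inj_iff hl.nodup).1 hij
  · exact List.ext_getElem (by simp [hlen]) (by simp [-List.ofFn_succ])

theorem free_pathOfLength_iff {m : ℕ} : (pathOfLength m).Free G ↔ NoPath G (m + 1) := by
  constructor
  · intro hfree l hl
    by_contra! hlen
    obtain ⟨f, -⟩ := (hl.of_isInfix
      ⟨[], l.drop (m + 1), l.take_append_drop (m + 1)⟩).exists_copy (m := m) (by simp [hlen])
    exact hfree ⟨f⟩
  · rintro h ⟨f⟩
    simpa using h _ (isPathList_ofFn f)

open Classical in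
/-- The neighbours of `x` in the finite set `U`. -/
noncomputable def nbhdIn (G : SimpleGraph V) (U : Finset V) (x : V) : Finset V :=
  {y ∈ U | G.Adj x y}

/-- The degree of `x` into the finite set `U`, which need not contain `x`. -/
noncomputable abbrev degIn (G : SimpleGraph V) (U : Finset V) (x : V) : ℕ := #(nbhdIn G U x)

@[simp]
theorem mem_nbhdIn {U : Finset V} {x y : V} : y ∈ nbhdIn G U x ↔ y ∈ U ∧ G.Adj x y := by
  simp [nbhdIn]

theorem nbhdIn_subset (U : Finset V) (x : V) : nbhdIn G U x ⊆ U := fun _ hy => (mem_nbhdIn.1 hy).1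

theorem nbhdIn_mono {U U' : Finset V} (h : U ⊆ U') (x : V) : nbhdIn G U x ⊆ nbhdIn G U' x :=
  fun _ hy => mem_nbhdIn.2 ⟨h (mem_nbhdIn.1 hy).1, (mem_nbhdIn.1 hy).2⟩

theorem degIn_mono {U U' : Finset V} (h : U ⊆ U') (x : V) : degIn G U x ≤ degIn G U' x :=
  card_le_card (nbhdIn_mono h x)

theorem degIn_union_le [DecidableEq V] (U U' : Finset V) (x : V) :
    degIn G (U ∪ U') x ≤ degIn G U x + degIn G U' x := by
  refine (card_le_card fun y hy => ?_).trans (card_union_le _ _)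
  simpa only [mem_union, mem_nbhdIn, or_and_right] using hy

theorem degIn_le_card (U : Finset V) (x : V) : degIn G U x ≤ #U := card_le_card (nbhdIn_subset U x)

theorem degIn_pos_iff {U : Finset V} {x : V} : 0 < degIn G U x ↔ ∃ y ∈ U, G.Adj x y := by
  simp [Finset.card_pos, Finset.Nonempty]

theorem sum_degIn_comm (U U' : Finset V) :
    ∑ x ∈ U, degIn G U' x = ∑ y ∈ U', degIn G U y := by
  classical
  calc ∑ x ∈ U, degIn G U' x = ∑ y ∈ U', #{x ∈ U | G.Adj x y} :=
        sum_card_bipartiteAbove_eq_sum_card_bipartiteBelow G.Adj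
    _ = ∑ y ∈ U', degIn G U y := sum_congr rfl fun y _ => by simp only [degIn, nbhdIn, G.adj_comm y]

/-- A path grows at its first vertex `u` as long as it has not used up the neighbours of its
first vertex in `U`. -/
theorem exists_greedy_extension [DecidableEq V] {U : Finset V} {q : ℕ}
    (hU : ∀ u ∈ U, q ≤ degIn G U u) (i : ℕ) {u : V} {r : List V} (hpath : IsPathList G (u :: r))
    (hu : u ∈ U) (hi : #(r.toFinset ∩ U) + i ≤ q) :
    ∃ s : List V, IsPathList G (s ++ u :: r) ∧ s.length = i ∧ ∀ x ∈ s, x ∈ U := by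
  induction i generalizing u r with
  | zero => exact ⟨[], hpath, rfl, by simp⟩
  | succ i ih =>
    obtain ⟨w, hw, hwr⟩ : ∃ w ∈ nbhdIn G U u, w ∉ r.toFinset ∩ U :=
      exists_mem_notMem_of_card_lt_card ((by lia : _ < q).trans_le (hU u hu))
    obtain ⟨hwU, huw⟩ := mem_nbhdIn.1 hw
    have hnew : w ∉ u :: r := by
      simp only [mem_inter, List.mem_toFinset, hwU, and_true] at hwr
      simp [hwr, huw.ne']
    have hcount : #((u :: r).toFinset ∩ U) ≤ #(r.toFinset ∩ U) + 1 := by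
      rw [List.toFinset_cons, insert_inter_of_mem hu]
      exact card_insert_le _ _
    obtain ⟨s, hs, hlen, hsU⟩ := ih (hpath.cons huw.symm hnew) hwU (by lia)
    refine ⟨s ++ [w], by simpa using hs, by simp [hlen], ?_⟩
    simp only [List.mem_append, List.mem_singleton]
    rintro x (hx | rfl)
    exacts [hsU x hx, hwU]

theorem NoPath.exists_degIn_lt {q : ℕ} (h : NoPath G (q + 1)) {U : Finset V} (hU : U.Nonempty) :
    ∃ x ∈ U, degIn G U x < q := by
  classical
  by_contra! hdeg
  obtain ⟨u, hu⟩ := hU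
  obtain ⟨s, hs, hlen, -⟩ :=
    exists_greedy_extension hdeg q (isPathList_singleton u) hu (by simp)
  simpa [hlen] using h _ hs

theorem sum_degIn_eq_sum_erase_add [DecidableEq V] {U : Finset V} {x : V} (hx : x ∈ U) :
    ∑ y ∈ U, degIn G U y = ∑ y ∈ U.erase x, degIn G (U.erase x) y + 2 * degIn G U x := by
  classical
  have hdeg : ∀ y, degIn G U y = degIn G (U.erase x) y + if G.Adj y x then 1 else 0 := by
    intro y
    simp only [degIn, nbhdIn, card_filter]
    exact (sum_erase_add U _ hx).symm
  have hself : degIn G U x = degIn G (U.erase x) x := by simp [hdeg x]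
  have hsum : ∑ y ∈ U.erase x, (if G.Adj y x then 1 else 0) = degIn G (U.erase x) x := by
    simp only [degIn, nbhdIn, card_filter, G.adj_comm x]
  rw [← sum_erase_add U _ hx, sum_congr rfl fun y _ => hdeg y, sum_add_distrib, hsum, hself]
  ring

/-- The hypothesis says that the subgraph induced by `U` is `q`-degenerate. -/
theorem sum_degIn_le_of_degenerate {q : ℕ} (U : Finset V)
    (h : ∀ U' ⊆ U, U'.Nonempty → ∃ x ∈ U', degIn G U' x ≤ q) :
    ∑ x ∈ U, degIn G U x ≤ 2 * q * #U := by
  classical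
  induction hn : #U generalizing U with
  | zero => simp [card_eq_zero.1 hn]
  | succ n ih =>
    obtain ⟨x, hx, hxq⟩ := h U subset_rfl (card_pos.1 (by lia))
    have herase := ih (U.erase x) (fun U' hU' => h U' (hU'.trans (erase_subset _ _)))
      (by simp [hx, hn])
    rw [sum_degIn_eq_sum_erase_add hx]
    linarith

theorem NoPath.sum_degIn_le {q : ℕ} (h : NoPath G (q + 1)) (U : Finset V) :
    ∑ x ∈ U, degIn G U x ≤ 2 * q * #U :=
  sum_degIn_le_of_degenerate U fun _ _ hne =>
    (h.exists_degIn_lt hne).imp fun _ hx => ⟨hx.1, hx.2.le⟩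

end Paths

section Cleaning

variable {V : Type*} [DecidableEq V] {G : SimpleGraph V} {t : ℕ} {L Z : Finset V}

/-- `x` has neighbours in `L`, and together with the number of vertices of some path ending at `x`
and avoiding `L ∪ Z` their number is at least `t + 2`. -/
def Overfull (G : SimpleGraph V) (t : ℕ) (L Z : Finset V) (x : V) : Prop :=
  0 < degIn G L x ∧ ∃ l, IsPathList G l ∧ x ∈ l.getLast? ∧ (∀ v ∈ l, v ∉ L ∪ Z) ∧
    t + 2 ≤ l.length + degIn G L x

theorem overfull_antitone (G : SimpleGraph V) (t : ℕ) (L : Finset V) (x : V) :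
    Antitone fun Z => Overfull G t L Z x :=
  fun _ _ hZ ⟨hpos, l, hl, hx, hav, hlen⟩ =>
    ⟨hpos, l, hl, hx, fun v hv hv' => hav v hv (union_subset_union_right hZ hv'), hlen⟩

theorem overfull_sdiff_iff {x : V} : Overfull G t L (Z \ L) x ↔ Overfull G t L Z x := by
  simp only [Overfull, union_sdiff_self_eq_union]

/-- Killing robustly: whenever some property of a vertex of `L` can be destroyed by `c` more
vertices, these are added to `Z`. -/
theorem exists_forall_robust {α : Type*} (L : Finset α) {P : α → Finset V → Prop}
    (hP : ∀ a, Antitone (P a)) (c : ℕ) :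
    ∃ Z : Finset V, #Z ≤ c * #L ∧ ∀ a ∈ L, P a Z → ∀ S : Finset V, #S ≤ c → P a (Z ∪ S) := by
  classical
  suffices H : ∀ Z₀ : Finset V, ∃ Z, Z₀ ⊆ Z ∧ #Z ≤ #Z₀ + c * #L ∧
      ∀ a ∈ L, P a Z → ∀ S : Finset V, #S ≤ c → P a (Z ∪ S) by
    simpa using H ∅
  induction hn : #L generalizing L with
  | zero => exact fun Z₀ => ⟨Z₀, subset_rfl, by simp, by simp [card_eq_zero.1 hn]⟩
  | succ n ih =>
    intro Z₀
    by_cases hrob : ∀ a ∈ L, P a Z₀ → ∀ S : Finset V, #S ≤ c → P a (Z₀ ∪ S)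
    · exact ⟨Z₀, subset_rfl, by simp, hrob⟩
    push Not at hrob
    obtain ⟨a, haL, -, S, hS, haS⟩ := hrob
    obtain ⟨Z, hsub, hcard, hZ⟩ := ih (L.erase a) (by simp [haL, hn]) (Z₀ ∪ S)
    refine ⟨Z, subset_union_left.trans hsub, ?_, fun b hb hbZ => ?_⟩
    · have := card_union_le Z₀ S
      linarith
    · have hba : b ≠ a := fun hba => haS (hP a hsub (hba ▸ hbZ))
      exact hZ b (mem_erase.2 ⟨hba, hb⟩) hbZ

/-- A path which starts at a vertex of `L` adjacent to an overfull vertex, and on which the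
vertices outside `L` outnumber those of `L` by at least `t + 1 - s`. -/
structure IsOverfullPath (G : SimpleGraph V) (t : ℕ) (L Z : Finset V) (s : ℕ) (a : V)
    (l : List V) : Prop where
  isPathList : IsPathList G (a :: l)
  mem : a ∈ L
  exists_overfull : ∃ x, Overfull G t L Z x ∧ G.Adj a x
  le_length_add : t + 1 + 2 * #((a :: l).toFinset ∩ L) ≤ (a :: l).length + s

/-- An overfull vertex `y` adjacent to the first vertex either has a neighbour in `L` off the path,
and the path grows by two vertices, or all its neighbours in `L` lie on the path, and the path that
makes `y` overfull can be attached, giving a path on `2 * t + 3` vertices. -/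
theorem IsOverfullPath.exists_cons_cons (hno : NoPath G (2 * t + 3)) {s : ℕ}
    (hs : ∀ x, Overfull G t L Z x → s ≤ degIn G L x)
    (hrob : ∀ a ∈ L, (∃ x, Overfull G t L Z x ∧ G.Adj a x) → ∀ S : Finset V, #S ≤ 2 * t + 3 →
      ∃ x, Overfull G t L (Z ∪ S) x ∧ G.Adj a x)
    {a : V} {l : List V} (h : IsOverfullPath G t L Z s a l) :
    ∃ b y, IsOverfullPath G t L Z s b (y :: a :: l) := by
  obtain ⟨y, hy, hay⟩ := hrob a h.mem h.exists_overfull (a :: l).toFinset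
    ((List.toFinset_card_le _).trans (hno _ h.isPathList).le)
  have hyZ : Overfull G t L Z y := overfull_antitone G t L y subset_union_left hy
  obtain ⟨-, p, hp, hyp, hav, hlen⟩ := hy
  have hdisj : p.Disjoint (a :: l) := fun v hv hv' =>
    hav v hv (mem_union_right _ (mem_union_right _ (List.mem_toFinset.2 hv')))
  have hymem : y ∈ p := List.mem_of_mem_getLast? hyp
  have hyL : y ∉ L := fun hyL => hav y hymem (mem_union_left _ hyL)
  obtain ⟨b, hb, hbl⟩ : ∃ b ∈ nbhdIn G L y, b ∉ a :: l := by
    by_contra! hall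
    have hdeg : degIn G L y ≤ #((a :: l).toFinset ∩ L) := card_le_card fun b hb =>
      mem_inter.2 ⟨List.mem_toFinset.2 (hall b hb), nbhdIn_subset _ _ hb⟩
    have hjoin : IsPathList G (p ++ a :: l) := by
      refine hp.append h.isPathList (fun x hx z hz => ?_) hdisj
      obtain rfl := Option.mem_unique hx hyp
      obtain rfl : a = z := by simpa using hz
      exact hay.symm
    have hlong := hno _ hjoin
    have := h.le_length_add
    have := hs y hyZ
    simp only [List.length_append] at hlong
    lia
  obtain ⟨hbL, hyb⟩ := mem_nbhdIn.1 hb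
  have hby : b ∉ y :: a :: l := by
    simpa [hyb.ne'] using hbl
  refine ⟨b, y, (h.isPathList.cons hay.symm (hdisj hymem)).cons hyb.symm hby, hbL,
    ⟨y, hyZ, hyb.symm⟩, ?_⟩
  have hcount : #((b :: y :: a :: l).toFinset ∩ L) ≤ #((a :: l).toFinset ∩ L) + 1 := by
    rw [List.toFinset_cons, insert_inter_of_mem hbL, List.toFinset_cons,
      insert_inter_of_notMem hyL]
    exact card_insert_le _ _
  have := h.le_length_add
  simp only [List.length_cons] at this ⊢
  lia

theorem not_overfull_of_robust (hno : NoPath G (2 * t + 3))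
    (hrob : ∀ a ∈ L, (∃ x, Overfull G t L Z x ∧ G.Adj a x) → ∀ S : Finset V, #S ≤ 2 * t + 3 →
      ∃ x, Overfull G t L (Z ∪ S) x ∧ G.Adj a x) (x : V) : ¬ Overfull G t L Z x := by
  intro hx
  obtain ⟨y, hy, hmin⟩ : ∃ y, Overfull G t L Z y ∧
      ∀ z, Overfull G t L Z z → degIn G L y ≤ degIn G L z := by
    obtain ⟨y, hy, hmin⟩ := WellFounded.has_min (measure (degIn G L)).wf
      {y | Overfull G t L Z y} ⟨x, hx⟩
    exact ⟨y, hy, fun z hz => not_lt.1 (hmin z hz)⟩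
  have hnone : ∀ n a l, 2 * t + 3 ≤ l.length + n →
      ¬ IsOverfullPath G t L Z (degIn G L y) a l := by
    intro n
    induction n with
    | zero =>
      intro a l hn h
      have := hno _ h.isPathList
      simp only [List.length_cons] at this
      lia
    | succ n ih =>
      intro a l hn h
      obtain ⟨b, z, h'⟩ := h.exists_cons_cons hno hmin hrob
      exact ih b (z :: a :: l) (by simp only [List.length_cons]; lia) h'
  obtain ⟨hpos, p, hp, hyp, hav, hlen⟩ := id hy
  obtain ⟨a, haL, hya⟩ := degIn_pos_iff.1 hpos
  have hap : a ∉ p := fun hap => hav a hap (mem_union_left _ haL)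
  have hpL : p.toFinset ∩ L = ∅ := by
    simp only [← disjoint_iff_inter_eq_empty, disjoint_left, List.mem_toFinset]
    exact fun v hv hvL => hav v hv (mem_union_left _ hvL)
  refine hnone (2 * t + 3) a p.reverse (by lia) ⟨?_, haL, ⟨y, hy, hya.symm⟩, ?_⟩
  · refine (isPathList_singleton a).append hp.reverse (fun b hb z hz => ?_) (by simpa using hap)
    obtain rfl : a = b := by simpa using hb
    obtain rfl := Option.mem_unique (List.head?_reverse ▸ hz) hyp
    exact hya.symm
  · rw [List.toFinset_cons, List.toFinset_reverse, insert_inter_of_mem haL, hpL]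
    simp only [insert_empty, card_singleton, List.length_cons, List.length_reverse]
    lia

theorem exists_cleaning_set (hno : NoPath G (2 * t + 3)) (L : Finset V) :
    ∃ Z : Finset V, Disjoint L Z ∧ #Z ≤ (2 * t + 3) * #L ∧ ∀ x, ¬ Overfull G t L Z x := by
  obtain ⟨Z, hcard, hrob⟩ := exists_forall_robust L
    (P := fun a Z => ∃ x, Overfull G t L Z x ∧ G.Adj a x)
    (fun a _ _ hZ ⟨x, hx, hax⟩ => ⟨x, overfull_antitone G t L x hZ hx, hax⟩) (2 * t + 3)
  exact ⟨Z \ L, disjoint_sdiff, (card_le_card sdiff_subset).trans hcard,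
    fun x hx => not_overfull_of_robust hno hrob x (overfull_sdiff_iff.1 hx)⟩

theorem sum_degIn_compl_union_add_le [Fintype V] (hLZ : Disjoint L Z) :
    ∑ x ∈ (L ∪ Z)ᶜ, degIn G (L ∪ Z)ᶜ x + ∑ x ∈ Z, degIn G (L ∪ Z)ᶜ x ≤
      ∑ x ∈ Lᶜ, degIn G Lᶜ x := by
  have hsub : (L ∪ Z)ᶜ ⊆ Lᶜ := compl_subset_compl.2 subset_union_left
  have hZ : Z ⊆ Lᶜ := subset_compl_comm.1 (subset_compl_iff_disjoint_right.2 hLZ)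
  rw [← sum_union (disjoint_compl_left.mono_right subset_union_right)]
  calc ∑ x ∈ (L ∪ Z)ᶜ ∪ Z, degIn G (L ∪ Z)ᶜ x
      ≤ ∑ x ∈ (L ∪ Z)ᶜ ∪ Z, degIn G Lᶜ x := sum_le_sum fun x _ => degIn_mono hsub x
    _ ≤ ∑ x ∈ Lᶜ, degIn G Lᶜ x := sum_le_sum_of_subset (union_subset hsub hZ)

/-- Enlarging `L` by the cleaning set at most `r` times: each time the cleaning set sends more than
`m` edges to the remaining vertices, the degree sum outside drops by more than `m`. -/
theorem exists_sparse_cleaning_set [Fintype V] (hno : NoPath G (2 * t + 3)) (m r : ℕ)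
    (L : Finset V) (hL : ∑ x ∈ Lᶜ, degIn G Lᶜ x ≤ r * m) :
    ∃ L' Z : Finset V, L ⊆ L' ∧ #(L' ∪ Z) ≤ (2 * t + 4) ^ (r + 1) * #L ∧
      ∑ x ∈ Z, degIn G (L' ∪ Z)ᶜ x ≤ m ∧ ∀ x, ¬ Overfull G t L' Z x := by
  induction r generalizing L with
  | zero =>
    obtain ⟨Z, hLZ, hcard, hZ⟩ := exists_cleaning_set hno L
    have hdrop := sum_degIn_compl_union_add_le (G := G) hLZ
    have := card_union_le L Z
    exact ⟨L, Z, subset_rfl, by rw [zero_add, pow_one]; linarith, by lia, hZ⟩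
  | succ r ih =>
    obtain ⟨Z, hLZ, hcard, hZ⟩ := exists_cleaning_set hno L
    have hdrop := sum_degIn_compl_union_add_le (G := G) hLZ
    have hunion : #(L ∪ Z) ≤ (2 * t + 4) * #L := by linarith [card_union_le L Z]
    by_cases hm : ∑ x ∈ Z, degIn G (L ∪ Z)ᶜ x ≤ m
    · exact ⟨L, Z, subset_rfl,
        hunion.trans (Nat.mul_le_mul_right _ (Nat.le_self_pow (by lia) _)), hm, hZ⟩
    · obtain ⟨L', Z', hLL', hcard', hsum', hZ'⟩ := ih (L ∪ Z) (by rw [add_mul] at hL; lia)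
      refine ⟨L', Z', subset_union_left.trans hLL', hcard'.trans ?_, hsum', hZ'⟩
      calc (2 * t + 4) ^ (r + 1) * #(L ∪ Z)
          ≤ (2 * t + 4) ^ (r + 1) * ((2 * t + 4) * #L) := Nat.mul_le_mul_left _ hunion
        _ = (2 * t + 4) ^ (r + 1 + 1) * #L := by ring

end Cleaning

section Weights

variable {V : Type*} {G : SimpleGraph V} {t : ℕ} {L W : Finset V}

theorem exists_suffix_cons_disjoint {α : Type*} {U : Finset α} :
    ∀ {l : List α}, (∃ x ∈ l, x ∈ U) → ∃ v s, v :: s <:+ l ∧ v ∈ U ∧ ∀ x ∈ s, x ∉ U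
  | [], h => by simp at h
  | a :: l, h => by
    by_cases hl : ∃ x ∈ l, x ∈ U
    · obtain ⟨v, s, hs, hv, hsU⟩ := exists_suffix_cons_disjoint hl
      exact ⟨v, s, hs.trans (List.suffix_cons a l), hv, hsU⟩
    · push Not at hl
      obtain ⟨x, hx, hxU⟩ := h
      obtain rfl : x = a := (List.mem_cons.1 hx).resolve_right fun hxl => hl x hxl hxU
      exact ⟨x, l, List.suffix_rfl, hxU, hl⟩

/-- There is a path from `x` to `z` all of whose vertices lie in `W`. -/
def ReachableIn (G : SimpleGraph V) (W : Finset V) (x z : V) : Prop :=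
  ∃ l, IsPathList G (x :: l) ∧ z ∈ (x :: l).getLast? ∧ ∀ v ∈ x :: l, v ∈ W

theorem ReachableIn.refl {x : V} (hx : x ∈ W) : ReachableIn G W x x :=
  ⟨[], isPathList_singleton x, by simp, by simpa using hx⟩

theorem ReachableIn.mem {x z : V} (h : ReachableIn G W x z) : z ∈ W := by
  obtain ⟨l, -, hz, hW⟩ := h
  exact hW z (List.mem_of_mem_getLast? hz)

theorem getLast?_eq_of_cons_suffix {α : Type*} {v : α} {s l : List α} (h : v :: s <:+ l) :
    (v :: s).getLast? = l.getLast? := by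
  obtain ⟨p, rfl⟩ := h
  rw [List.getLast?_append_of_ne_nil p (List.cons_ne_nil v s)]

theorem ReachableIn.of_adj {x y z : V} (h : ReachableIn G W x z) (hy : y ∈ W)
    (hyx : G.Adj y x) : ReachableIn G W y z := by
  obtain ⟨l, hl, hz, hW⟩ := h
  by_cases hyl : y ∈ x :: l
  · obtain ⟨p, q, hpq⟩ := List.append_of_mem hyl
    have hq : y :: q <:+ x :: l := ⟨p, hpq.symm⟩
    exact ⟨q, hl.of_isInfix hq.isInfix, getLast?_eq_of_cons_suffix hq ▸ hz, fun v hv =>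
      hW v (hq.subset hv)⟩
  · refine ⟨x :: l, hl.cons hyx hyl, by simpa using hz, ?_⟩
    rw [List.forall_mem_cons]
    exact ⟨hy, hW⟩

/-- Cut a path from `U` to `z` at its last vertex in `U`. If all degrees in `U` were large, the
remainder could be prolonged inside `U`, and `z` would be overfull. -/
theorem exists_degIn_le_of_not_overfull [DecidableEq V] {Z U : Finset V}
    (h : ∀ x, ¬ Overfull G t L Z x) (hW : Disjoint W (L ∪ Z)) (hU : U ⊆ W) {u z : V} (hu : u ∈ U)
    (hreach : ReachableIn G W u z) (hz : 0 < degIn G L z) :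
    ∃ x ∈ U, degIn G U x ≤ t - degIn G L z := by
  by_contra! hdeg
  obtain ⟨l, hl, hzl, hlW⟩ := hreach
  obtain ⟨v, s, hsuff, hv, hs⟩ := exists_suffix_cons_disjoint ⟨u, List.mem_cons_self, hu⟩
  have hsU : s.toFinset ∩ U = ∅ := by
    simpa only [← disjoint_iff_inter_eq_empty, disjoint_left, List.mem_toFinset] using hs
  obtain ⟨w, hw, hwlen, hwU⟩ := exists_greedy_extension (q := t - degIn G L z + 1) hdeg
    (t - degIn G L z + 1) (hl.of_isInfix hsuff.isInfix) hv (by simp [hsU])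
  refine h z ⟨hz, w ++ v :: s, hw, ?_, fun x hx => ?_, ?_⟩
  · rwa [List.getLast?_append_of_ne_nil _ (by simp), getLast?_eq_of_cons_suffix hsuff]
  · refine disjoint_left.1 hW ?_
    rcases List.mem_append.1 hx with hx | hx
    exacts [hU (hwU x hx), hlW x (hsuff.subset hx)]
  · simp only [List.length_append, List.length_cons]
    lia

open Classical in
/-- The largest degree into `L` of a vertex in the component of `x` in the subgraph induced by
`W`. -/
noncomputable def componentDeg (G : SimpleGraph V) (L W : Finset V) (x : V) : ℕ :=
  {z ∈ W | ReachableIn G W x z}.sup (degIn G L)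

theorem ReachableIn.degIn_le {x z : V} (h : ReachableIn G W x z) :
    degIn G L z ≤ componentDeg G L W x := by
  classical
  exact le_sup (f := degIn G L) (mem_filter.2 ⟨h.mem, h⟩)

theorem exists_degIn_eq_componentDeg {x : V} (hx : x ∈ W) :
    ∃ z, ReachableIn G W x z ∧ degIn G L z = componentDeg G L W x := by
  classical
  obtain ⟨z, hz, hzx⟩ := exists_mem_eq_sup {z ∈ W | ReachableIn G W x z}
    ⟨x, mem_filter.2 ⟨hx, .refl hx⟩⟩ (degIn G L)
  exact ⟨z, (mem_filter.1 hz).2, hzx.symm⟩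

theorem componentDeg_eq_of_adj {x y : V} (hx : x ∈ W) (hy : y ∈ W) (hxy : G.Adj x y) :
    componentDeg G L W x = componentDeg G L W y := by
  suffices H : ∀ x ∈ W, ∀ y ∈ W, G.Adj x y → componentDeg G L W x ≤ componentDeg G L W y from
    (H x hx y hy hxy).antisymm (H y hy x hx hxy.symm)
  intro x hx y hy hxy
  obtain ⟨z, hz, hzx⟩ := exists_degIn_eq_componentDeg (G := G) (L := L) hx
  exact hzx ▸ (hz.of_adj hy hxy.symm).degIn_le

theorem degIn_componentDeg_fiber {x : V} (hx : x ∈ W) :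
    degIn G {y ∈ W | componentDeg G L W y = componentDeg G L W x} x = degIn G W x := by
  refine congrArg Finset.card (Finset.ext fun y => ?_)
  rw [mem_nbhdIn, mem_nbhdIn, mem_filter, and_congr_left_iff, and_iff_left_iff_imp]
  exact fun hxy hy => (componentDeg_eq_of_adj hx hy hxy).symm

theorem sum_degIn_componentDeg_fiber_le [DecidableEq V] {Z : Finset V}
    (h : ∀ x, ¬ Overfull G t L Z x) (hW : Disjoint W (L ∪ Z)) {j : ℕ} (hj : 0 < j) :
    ∑ x ∈ W with componentDeg G L W x = j, degIn G W x ≤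
      2 * (t - j) * #{x ∈ W | componentDeg G L W x = j} := by
  refine (sum_congr rfl fun x hx => ?_).trans_le (sum_degIn_le_of_degenerate (G := G) _ ?_)
  · obtain ⟨hxW, rfl⟩ := mem_filter.1 hx
    exact (degIn_componentDeg_fiber hxW).symm
  · rintro U hU ⟨u, hu⟩
    obtain ⟨huW, huj⟩ := mem_filter.1 (hU hu)
    obtain ⟨z, hz, hzu⟩ := exists_degIn_eq_componentDeg (G := G) (L := L) huW
    have hzj : degIn G L z = j := hzu.trans huj
    simpa only [hzj] using exists_degIn_le_of_not_overfull h hW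
      (hU.trans (filter_subset _ _)) hu hz (hzj ▸ hj)

/-- The share of a vertex with `s` neighbours in `L` in the bound `pairWeight_bound` on the number
of paths on four vertices attached to a pair of vertices. The leading term is attained by twins,
and the second one pays for the pairs with `s = s' = 1`. -/
def pairWeight (s : ℕ) : ℕ := 3 * s * (s - 1) + if s = 1 then 1 else 0

theorem pairWeight_of_two_le {s : ℕ} (hs : 2 ≤ s) : pairWeight s = 3 * s * (s - 1) := by
  rw [pairWeight, if_neg (by lia), add_zero]

theorem pairWeight_mono : Monotone pairWeight := by
  refine monotone_nat_of_le_succ fun s => ?_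
  match s with
  | 0 => decide
  | 1 => decide
  | s + 2 =>
    rw [pairWeight_of_two_le (by lia), pairWeight_of_two_le (by lia)]
    exact Nat.mul_le_mul (by lia) (by lia)

theorem pairWeight_add_lt {t j : ℕ} (ht : 2 ≤ t) (hj : j < t) :
    pairWeight j + 4 * j * (t - j) < 3 * t * (t - 1) := by
  obtain ⟨d, rfl⟩ := Nat.exists_eq_add_of_lt hj
  match j with
  | 0 =>
    simp only [pairWeight, mul_zero, zero_mul, zero_ne_one, ↓reduceIte, add_zero]
    exact Nat.mul_pos (by lia) (by lia)
  | 1 =>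
    simp only [pairWeight, mul_one, tsub_self, mul_zero, ↓reduceIte, zero_add,
      add_tsub_cancel_right]
    nlinarith
  | j + 2 =>
    rw [pairWeight_of_two_le (by lia), show j + 2 + d + 1 - (j + 2) = d + 1 by lia,
      show j + 2 - 1 = j + 1 by lia, show j + 2 + d + 1 - 1 = j + d + 2 by lia]
    nlinarith [Nat.zero_le (j * d), Nat.zero_le (d * d)]

theorem degIn_le_of_not_overfull [DecidableEq V] {Z : Finset V} (h : ∀ x, ¬ Overfull G t L Z x)
    {x : V} (hx : x ∉ L ∪ Z) : degIn G L x ≤ t := by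
  by_contra! hlt
  refine h x ⟨by lia, [x], isPathList_singleton x, by simp, by simpa using hx, ?_⟩
  simp only [List.length_singleton]
  lia

theorem sum_pairWeight_fiber_le [DecidableEq V] {Z : Finset V} (ht : 2 ≤ t)
    (h : ∀ x, ¬ Overfull G t L Z x) (hW : Disjoint W (L ∪ Z)) {j : ℕ} (hj : j ≤ t) :
    ∑ x ∈ W with componentDeg G L W x = j,
        (pairWeight (degIn G L x) + 2 * degIn G L x * degIn G W x +
          if degIn G L x < t then 1 else 0) ≤
      3 * t * (t - 1) * #{x ∈ W | componentDeg G L W x = j} := by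
  set U : Finset V := {x ∈ W | componentDeg G L W x = j} with hU
  have hdeg : ∀ x ∈ U, degIn G L x ≤ j := fun x hx => by
    obtain ⟨hxW, rfl⟩ := mem_filter.1 hx
    exact (ReachableIn.refl hxW).degIn_le
  have hsum : 2 * j * ∑ x ∈ U, degIn G W x ≤ 4 * j * (t - j) * #U := by
    rcases j.eq_zero_or_pos with rfl | hj0
    · simp
    · calc 2 * j * ∑ x ∈ U, degIn G W x ≤ 2 * j * (2 * (t - j) * #U) :=
            Nat.mul_le_mul_left _ (sum_degIn_componentDeg_fiber_le h hW hj0)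
        _ = 4 * j * (t - j) * #U := by ring
  rcases hj.lt_or_eq with hlt | rfl
  · calc ∑ x ∈ U, (pairWeight (degIn G L x) + 2 * degIn G L x * degIn G W x +
          if degIn G L x < t then 1 else 0)
        ≤ ∑ x ∈ U, (pairWeight j + 2 * j * degIn G W x + 1) := by
          refine sum_le_sum fun x hx => ?_
          gcongr
          · exact pairWeight_mono (hdeg x hx)
          · exact hdeg x hx
          · split_ifs <;> simp
      _ = pairWeight j * #U + 2 * j * ∑ x ∈ U, degIn G W x + #U := by
          simp only [sum_add_distrib, ← mul_sum, sum_const, smul_eq_mul]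
          ring
      _ ≤ (pairWeight j + 4 * j * (t - j) + 1) * #U := by linarith
      _ ≤ 3 * t * (t - 1) * #U := Nat.mul_le_mul_right _ (pairWeight_add_lt ht hlt)
  · have hzero : ∑ x ∈ U, degIn G W x = 0 := by
      simpa [show j ≠ 0 by lia] using hsum
    rw [sum_eq_zero_iff] at hzero
    rw [mul_comm, ← smul_eq_mul, ← sum_const]
    refine sum_le_sum fun x hx => ?_
    rw [hzero x hx, mul_zero, add_zero]
    rcases (hdeg x hx).lt_or_eq with hlt | heq
    · rw [if_pos hlt]
      exact (Nat.le_add_right _ _).trans_lt (pairWeight_add_lt ht hlt)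
    · rw [heq, if_neg (lt_irrefl j), pairWeight_of_two_le ht, add_zero]

theorem sum_pairWeight_le [DecidableEq V] {Z : Finset V} (ht : 2 ≤ t)
    (h : ∀ x, ¬ Overfull G t L Z x) (hW : Disjoint W (L ∪ Z)) :
    ∑ x ∈ W, (pairWeight (degIn G L x) + 2 * degIn G L x * degIn G W x +
        if degIn G L x < t then 1 else 0) ≤ 3 * t * (t - 1) * #W := by
  have hmaps : ∀ x ∈ W, componentDeg G L W x ∈ range (t + 1) := fun x hx => by
    obtain ⟨z, hz, hzx⟩ := exists_degIn_eq_componentDeg (G := G) (L := L) hx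
    rw [mem_range, Nat.lt_succ_iff, ← hzx]
    exact degIn_le_of_not_overfull h (disjoint_left.1 hW hz.mem)
  rw [← sum_fiberwise_of_maps_to hmaps, card_eq_sum_card_fiberwise hmaps, mul_sum]
  exact sum_le_sum fun j hj => sum_pairWeight_fiber_le ht h hW (Nat.lt_succ_iff.1 (mem_range.1 hj))

end Weights

section Counting

variable {V : Type*} {G : SimpleGraph V}

open Classical in
/-- The number of common neighbours of `x` and `y` in the finite set `A`. -/
noncomputable def codegIn (G : SimpleGraph V) (A : Finset V) (x y : V) : ℕ :=
  #{a ∈ nbhdIn G A x | G.Adj y a}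

theorem codegIn_comm (A : Finset V) (x y : V) : codegIn G A x y = codegIn G A y x := by
  unfold codegIn
  congr 1
  ext a
  simp only [mem_filter, mem_nbhdIn]
  tauto

theorem codegIn_le_left (A : Finset V) (x y : V) : codegIn G A x y ≤ degIn G A x := by
  classical
  exact card_le_card (filter_subset _ _)

theorem codegIn_le_right (A : Finset V) (x y : V) : codegIn G A x y ≤ degIn G A y :=
  codegIn_comm (G := G) A x y ▸ codegIn_le_left A y x

theorem inter_nbhdIn [DecidableEq V] {A B : Finset V} (hAB : A ⊆ B) (x y : V) :
    #(nbhdIn G A x ∩ nbhdIn G B y) = codegIn G A x y := by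
  rw [codegIn]
  congr 1
  ext a
  have := @hAB a
  simp only [mem_inter, mem_nbhdIn, mem_filter]
  tauto

theorem pairWeight_bound {s s' i t : ℕ} (ht : 2 ≤ t) (hi : i ≤ s) (hi' : i ≤ s') :
    2 * (s * s' + i * s + i * s') + 2 * (if s = t ∧ s' = t ∧ i < t then 1 else 0) ≤
      pairWeight s + pairWeight s' + 6 * i := by
  wlog hss : s ≤ s' generalizing s s'
  · have := this hi' hi (by lia)
    simp only [and_left_comm (a := s' = t)] at this
    linarith
  rcases s.eq_zero_or_pos with rfl | hs
  · obtain rfl : i = 0 := by lia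
    simp [show 0 ≠ t by lia]
  rcases lt_or_ge (s + s') 3 with h3 | h3
  · obtain rfl : s = 1 := by lia
    obtain rfl : s' = 1 := by lia
    simp only [mul_one, show 1 ≠ t by lia, false_and, and_self, ↓reduceIte, mul_zero, add_zero,
      pairWeight, tsub_self, zero_add]
    lia
  have hpw : ∀ j : ℕ, (3 * j * j : ℤ) - 3 * j ≤ pairWeight j := by
    rintro (_ | j)
    · simp
    · rw [pairWeight, Nat.add_sub_cancel]
      split_ifs <;> push_cast <;> linarith
  have hs := hpw s
  have hs' := hpw s'
  split_ifs with hst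
  · obtain ⟨rfl, rfl, hlt⟩ := hst
    zify at *
    have : (i : ℤ) * (2 * s' - 3) ≤ (s' - 1) * (2 * s' - 3) :=
      mul_le_mul_of_nonneg_right (by lia) (by lia)
    linarith
  · zify at hi hi' hss hs h3 ⊢
    have hmax : (i : ℤ) * (s + s' - 3) ≤ s * (s + s' - 3) :=
      mul_le_mul_of_nonneg_right hi (by lia)
    have hfactor : (0 : ℤ) ≤ (s' - s) * (3 * s' - s - 3) := by
      rcases hss.lt_or_eq with h | h
      · exact mul_nonneg (by lia) (by lia)
      · rw [h]; simp
    linarith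

theorem sum_codegIn_mul_degIn_le {t : ℕ} (ht : 2 ≤ t) (L W : Finset V) :
    ∑ x ∈ W, ∑ y ∈ W, degIn G L x * degIn G L y +
        2 * ∑ x ∈ W, ∑ y ∈ W, codegIn G L x y * degIn G L y +
        #{p ∈ W ×ˢ W | degIn G L p.1 = t ∧ degIn G L p.2 = t ∧ codegIn G L p.1 p.2 < t} ≤
      #W * ∑ x ∈ W, pairWeight (degIn G L x) + 3 * ∑ x ∈ W, ∑ y ∈ W, codegIn G L x y := by
  classical
  have hsymm : ∑ x ∈ W, ∑ y ∈ W, codegIn G L x y * degIn G L x =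
      ∑ x ∈ W, ∑ y ∈ W, codegIn G L x y * degIn G L y := by
    rw [sum_comm]
    simp only [codegIn_comm]
  have hpairs : ∑ x ∈ W, ∑ y ∈ W, (pairWeight (degIn G L x) + pairWeight (degIn G L y)) =
      2 * (#W * ∑ x ∈ W, pairWeight (degIn G L x)) := by
    simp only [sum_add_distrib, sum_const, smul_eq_mul, ← mul_sum]
    ring
  have hbound := sum_le_sum fun x (_ : x ∈ W) => sum_le_sum fun y (_ : y ∈ W) =>
    pairWeight_bound ht (codegIn_le_left (G := G) L x y) (codegIn_le_right L x y)
  simp only [sum_add_distrib, ← mul_sum, mul_add, hsymm] at hbound hpairs ⊢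
  rw [card_filter, sum_product]
  lia

theorem sum_codegIn_mul_degIn_union_le [DecidableEq V] (L W : Finset V) :
    ∑ x ∈ W, ∑ y ∈ W, codegIn G L x y * degIn G (L ∪ W) y ≤
      ∑ x ∈ W, ∑ y ∈ W, codegIn G L x y * degIn G L y +
        #W * ∑ x ∈ W, degIn G L x * degIn G W x := by
  rw [← smul_eq_mul, ← sum_const, ← sum_add_distrib]
  refine sum_le_sum fun x _ => ?_
  rw [← sum_add_distrib]
  refine sum_le_sum fun y _ => ?_
  grw [degIn_union_le, mul_add]
  gcongr
  exact codegIn_le_right L x y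

theorem card_filter_ne_product {α : Type*} [DecidableEq α] (A B : Finset α) :
    #{p ∈ A ×ˢ B | p.1 ≠ p.2} + #(A ∩ B) = #A * #B := by
  have hdiag : #(A ∩ B) = #{p ∈ A ×ˢ B | ¬ p.1 ≠ p.2} := by
    refine card_nbij' (fun a => (a, a)) Prod.fst ?_ ?_ ?_ ?_
    · simp +contextual [Set.MapsTo]
    · rintro ⟨a, b⟩ h
      simp only [mem_coe, mem_filter, mem_product, not_not] at h
      exact mem_inter.2 ⟨h.1.1, h.2 ▸ h.1.2⟩
    · simp [Set.LeftInvOn]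
    · simp +contextual [Set.LeftInvOn]
  rw [hdiag, card_filter_add_card_filter_not, card_product]

theorem card_le_sum_card {α β γ : Type*} {S : Finset α} {I : Finset β} {B : β → Finset γ}
    {f : α → β × γ} (hf : f.Injective) (hS : ∀ a ∈ S, (f a).1 ∈ I ∧ (f a).2 ∈ B (f a).1) :
    #S ≤ ∑ b ∈ I, #(B b) := by
  rw [← card_sigma]
  refine card_le_card_of_injOn (fun a => ⟨(f a).1, (f a).2⟩) (fun a ha => ?_)
    fun a _ b _ hab => hf ?_
  · exact mem_sigma.2 (hS a ha)
  · simpa [Prod.ext_iff] using hab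

theorem card_filter_ends_le {α : Type*} [DecidableEq α] (S : Finset (α × α × α × α))
    (E F : Finset (α × α)) :
    #{p ∈ S | (p.1, p.2.1) ∈ E ∧ (p.2.2.2, p.2.2.1) ∈ F ∨
      (p.2.2.2, p.2.2.1) ∈ E ∧ (p.1, p.2.1) ∈ F} ≤ 2 * (#E * #F) := by
  rw [filter_or, two_mul, ← smul_eq_mul, ← sum_const]
  refine (card_union_le _ _).trans (add_le_add
    (card_le_sum_card (f := fun p => ((p.1, p.2.1), (p.2.2.2, p.2.2.1))) ?_ ?_)
    (card_le_sum_card (f := fun p => ((p.2.2.2, p.2.2.1), (p.1, p.2.1))) ?_ ?_))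
  exacts [fun _ _ => by simp +contextual [Prod.ext_iff], fun p hp => (mem_filter.1 hp).2,
    fun _ _ => by simp +contextual [Prod.ext_iff], fun p hp => (mem_filter.1 hp).2]

variable [Fintype V]

open Classical in
/-- The paths of `G` on four vertices, as sequences of vertices, so that every path occurs twice. -/
noncomputable def fourPaths (G : SimpleGraph V) : Finset (V × V × V × V) :=
  {p | IsPathList G [p.1, p.2.1, p.2.2.1, p.2.2.2]}

theorem mem_fourPaths {x u v y : V} : (x, u, v, y) ∈ fourPaths G ↔
    G.Adj x u ∧ G.Adj u v ∧ G.Adj v y ∧ x ≠ v ∧ x ≠ y ∧ u ≠ y := by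
  have hpath : IsPathList G [x, u, v, y] ↔ [x, u, v, y].IsChain G.Adj ∧ [x, u, v, y].Nodup :=
    ⟨fun h => ⟨h.1, h.2⟩, fun h => ⟨h.1, h.2⟩⟩
  simp only [fourPaths, mem_filter, mem_univ, true_and, hpath, List.isChain_cons_cons,
    List.isChain_singleton, and_true, List.nodup_cons, List.mem_cons, List.not_mem_nil, or_false,
    not_or, not_false_eq_true, List.nodup_nil]
  constructor
  · tauto
  · rintro ⟨hxu, huv, hvy, hne⟩
    exact ⟨⟨hxu, huv, hvy⟩, ⟨hxu.ne, hne.1, hne.2.1⟩, ⟨huv.ne, hne.2.2⟩, hvy.ne⟩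

theorem mem_fourPaths_reverse {x u v y : V} :
    (x, u, v, y) ∈ fourPaths G ↔ (y, v, u, x) ∈ fourPaths G := by
  simp only [mem_fourPaths, G.adj_comm, ne_comm]
  tauto

open Classical in
/-- The paths on four vertices whose vertices lie in the given sets, in this order. -/
noncomputable def fourPathsIn (G : SimpleGraph V) (S₁ S₂ S₃ S₄ : Finset V) :
    Finset (V × V × V × V) :=
  {p ∈ fourPaths G | p.1 ∈ S₁ ∧ p.2.1 ∈ S₂ ∧ p.2.2.1 ∈ S₃ ∧ p.2.2.2 ∈ S₄}

theorem mem_fourPathsIn {S₁ S₂ S₃ S₄ : Finset V} {x u v y : V} :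
    (x, u, v, y) ∈ fourPathsIn G S₁ S₂ S₃ S₄ ↔
      (x, u, v, y) ∈ fourPaths G ∧ x ∈ S₁ ∧ u ∈ S₂ ∧ v ∈ S₃ ∧ y ∈ S₄ := by
  simp [fourPathsIn]

theorem card_fourPathsIn_reverse (S₁ S₂ S₃ S₄ : Finset V) :
    #(fourPathsIn G S₁ S₂ S₃ S₄) = #(fourPathsIn G S₄ S₃ S₂ S₁) := by
  suffices H : ∀ S₁ S₂ S₃ S₄ : Finset V,
      #(fourPathsIn G S₁ S₂ S₃ S₄) ≤ #(fourPathsIn G S₄ S₃ S₂ S₁) from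
    (H S₁ S₂ S₃ S₄).antisymm (H S₄ S₃ S₂ S₁)
  intro S₁ S₂ S₃ S₄
  refine card_le_card_of_injOn (fun p => (p.2.2.2, p.2.2.1, p.2.1, p.1)) ?_ ?_
  · rintro ⟨x, u, v, y⟩ h
    simp only [mem_coe, mem_fourPathsIn] at h ⊢
    exact ⟨mem_fourPaths_reverse.1 h.1, by tauto⟩
  · rintro ⟨x, u, v, y⟩ - ⟨x', u', v', y'⟩ - h
    simp only [Prod.mk.injEq] at h ⊢
    tauto

theorem card_fourPathsIn_add_le_of_ends (X A Y : Finset V) :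
    #(fourPathsIn G X A A Y) + ∑ x ∈ X, ∑ y ∈ Y, codegIn G A x y ≤
      ∑ x ∈ X, ∑ y ∈ Y, degIn G A x * degIn G A y := by
  classical
  have hle : #(fourPathsIn G X A A Y) ≤
      ∑ p ∈ X ×ˢ Y, #{q ∈ nbhdIn G A p.1 ×ˢ nbhdIn G A p.2 | q.1 ≠ q.2} := by
    refine card_le_sum_card (f := fun p => ((p.1, p.2.2.2), p.2.1, p.2.2.1))
      (fun _ _ => by simp +contextual [Prod.ext_iff]) ?_
    rintro ⟨x, u, v, y⟩ h
    rw [mem_fourPathsIn, mem_fourPaths] at h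
    simp [h, h.1.2.1.ne, h.1.2.2.1.symm]
  simp only [sum_product] at hle
  refine (Nat.add_le_add_right hle _).trans_eq ?_
  simp only [← sum_add_distrib, ← card_filter_ne_product, inter_nbhdIn subset_rfl]

theorem card_fourPathsIn_add_le_of_alternate {A B : Finset V} (hAB : A ⊆ B) (X Y : Finset V) :
    #(fourPathsIn G X A Y B) + ∑ x ∈ X, ∑ y ∈ Y, codegIn G A x y ≤
      ∑ x ∈ X, ∑ y ∈ Y, codegIn G A x y * degIn G B y := by
  classical
  have hle : #(fourPathsIn G X A Y B) ≤ ∑ p ∈ X ×ˢ Y,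
      #{q ∈ (nbhdIn G A p.1 ∩ nbhdIn G A p.2) ×ˢ nbhdIn G B p.2 | q.1 ≠ q.2} := by
    refine card_le_sum_card (f := fun p => ((p.1, p.2.2.1), p.2.1, p.2.2.2))
      (fun _ _ => by simp +contextual [Prod.ext_iff]) ?_
    rintro ⟨x, u, v, y⟩ h
    rw [mem_fourPathsIn, mem_fourPaths] at h
    simp [h, h.1.2.1.symm]
  simp only [sum_product] at hle
  refine (Nat.add_le_add_right hle _).trans_eq ?_
  simp only [← sum_add_distrib, ← inter_nbhdIn (G := G) (subset_refl A), ← card_filter_ne_product,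
    inter_assoc, inter_eq_left.2 (nbhdIn_mono hAB _)]

open Classical in
/-- The ordered pairs of adjacent vertices. -/
noncomputable def adjPairs (G : SimpleGraph V) : Finset (V × V) := {p | G.Adj p.1 p.2}

@[simp]
theorem mem_adjPairs {p : V × V} : p ∈ adjPairs G ↔ G.Adj p.1 p.2 := by simp [adjPairs]

theorem card_adjPairs : #(adjPairs G) = ∑ x, degIn G univ x := by
  simp only [adjPairs, degIn, nbhdIn, card_filter, ← univ_product_univ, sum_product]

theorem card_fourPathsIn_middle_le {W : Finset V} {D : ℕ} (hD : ∀ x ∈ W, degIn G univ x ≤ D) :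
    #(fourPathsIn G univ W W univ) ≤ D ^ 2 * #(adjPairs G) := by
  classical
  calc #(fourPathsIn G univ W W univ)
      ≤ ∑ p ∈ adjPairs G with p.1 ∈ W ∧ p.2 ∈ W,
          #(nbhdIn G univ p.1 ×ˢ nbhdIn G univ p.2) := by
        refine card_le_sum_card (f := fun p => ((p.2.1, p.2.2.1), p.1, p.2.2.2))
          (fun _ _ => by simp +contextual [Prod.ext_iff]) ?_
        rintro ⟨x, u, v, y⟩ h
        rw [mem_fourPathsIn, mem_fourPaths] at h
        simp [h, h.1.1.symm]
    _ ≤ ∑ p ∈ adjPairs G with p.1 ∈ W ∧ p.2 ∈ W, D ^ 2 := by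
        refine sum_le_sum fun p hp => ?_
        obtain ⟨-, h₁, h₂⟩ := mem_filter.1 hp
        rw [card_product, sq]
        exact Nat.mul_le_mul (hD _ h₁) (hD _ h₂)
    _ ≤ D ^ 2 * #(adjPairs G) := by
        rw [sum_const, smul_eq_mul, mul_comm]
        exact Nat.mul_le_mul_left _ (card_filter_le _ _)

theorem card_filter_fourPaths_le [DecidableEq V] (E : Finset (V × V)) :
    #{p ∈ fourPaths G | (p.1, p.2.1) ∈ E ∨ (p.2.2.2, p.2.2.1) ∈ E} ≤
      2 * (#E * #(adjPairs G)) := by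
  refine (card_le_card fun p hp => ?_).trans (card_filter_ends_le (fourPaths G) E (adjPairs G))
  rw [mem_filter] at hp ⊢
  obtain ⟨hxu, -, hvy, -⟩ := mem_fourPaths.1 hp.1
  simp only [mem_adjPairs, hxu, hvy.symm, and_true]
  exact hp

open Classical in
/-- The pairs of adjacent vertices which neither lie in `W` nor are divided between `L` and `W`. -/
noncomputable def exceptionalPairs (G : SimpleGraph V) (L W : Finset V) : Finset (V × V) :=
  {p ∈ adjPairs G | ¬ (p.1 ∈ W ∧ p.2 ∈ W ∨ p.1 ∈ W ∧ p.2 ∈ L ∨ p.1 ∈ L ∧ p.2 ∈ W)}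

theorem mem_exceptionalPairs {L W : Finset V} {p : V × V} : p ∈ exceptionalPairs G L W ↔
    G.Adj p.1 p.2 ∧ ¬ (p.1 ∈ W ∧ p.2 ∈ W ∨ p.1 ∈ W ∧ p.2 ∈ L ∨ p.1 ∈ L ∧ p.2 ∈ W) := by
  simp only [exceptionalPairs, mem_filter, mem_adjPairs]

theorem card_fourPaths_le_sum_fourPathsIn [DecidableEq V] (L W : Finset V) :
    #(fourPaths G) ≤ #(fourPathsIn G W L L W) + 2 * #(fourPathsIn G W L W (L ∪ W)) +
      #(fourPathsIn G univ W W univ) + 2 * (#(exceptionalPairs G L W) * #(adjPairs G)) := by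
  set E := exceptionalPairs G L W
  have hcover : fourPaths G ⊆ fourPathsIn G W L L W ∪ (fourPathsIn G W L W (L ∪ W) ∪
      (fourPathsIn G (L ∪ W) W L W ∪ (fourPathsIn G univ W W univ ∪
        {p ∈ fourPaths G | (p.1, p.2.1) ∈ E ∨ (p.2.2.2, p.2.2.1) ∈ E}))) := by
    rintro ⟨x, u, v, y⟩ hp
    simp only [mem_union, mem_filter, mem_fourPathsIn, mem_univ, hp, true_and, and_true]
    by_cases hbad : (x, u) ∈ E ∨ (y, v) ∈ E
    · simp only [hbad, or_true]
    have hgood : ∀ a b, G.Adj a b → (a, b) ∉ E →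
        a ∈ W ∧ b ∈ W ∨ a ∈ W ∧ b ∈ L ∨ a ∈ L ∧ b ∈ W := fun a b hab habE => by
      by_contra hnot
      exact habE (mem_exceptionalPairs.2 ⟨hab, hnot⟩)
    obtain ⟨hxu, -, hvy, -⟩ := mem_fourPaths.1 hp
    rw [not_or] at hbad
    rcases hgood x u hxu hbad.1 with ⟨hx, hu⟩ | ⟨hx, hu⟩ | ⟨hx, hu⟩ <;>
    rcases hgood y v hvy.symm hbad.2 with ⟨hy, hv⟩ | ⟨hy, hv⟩ | ⟨hy, hv⟩ <;>
      simp only [hx, hu, hy, hv, true_or, or_true, and_self]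
  refine (card_le_card hcover).trans ?_
  have hreverse := card_fourPathsIn_reverse (G := G) (L ∪ W) W L W
  have hends := card_filter_fourPaths_le (G := G) E
  grw [card_union_le, card_union_le, card_union_le, card_union_le, hends, hreverse]
  lia

theorem card_fourPaths_add_le {t : ℕ} (ht : 2 ≤ t)
    {L W : Finset V} {D : ℕ} (hD : ∀ x ∈ W, degIn G univ x ≤ D) :
    #(fourPaths G) +
        #{p ∈ W ×ˢ W | degIn G L p.1 = t ∧ degIn G L p.2 = t ∧ codegIn G L p.1 p.2 < t} ≤
      #W * ∑ x ∈ W, (pairWeight (degIn G L x) + 2 * degIn G L x * degIn G W x) +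
        D ^ 2 * #(adjPairs G) + 2 * (#(exceptionalPairs G L W) * #(adjPairs G)) := by
  classical
  have hcover := card_fourPaths_le_sum_fourPathsIn (G := G) L W
  have hends := card_fourPathsIn_add_le_of_ends (G := G) W L W
  have halternate :=
    card_fourPathsIn_add_le_of_alternate (G := G) (subset_union_left (s₂ := W)) (A := L) W W
  have hmiddle := card_fourPathsIn_middle_le hD
  have hpairs := sum_codegIn_mul_degIn_le (G := G) ht L W
  have hunion := sum_codegIn_mul_degIn_union_le (G := G) L W
  simp only [sum_add_distrib, mul_assoc 2, ← mul_sum, mul_add]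
  lia

end Counting

section Stability

variable {V : Type*} {G : SimpleGraph V}

/-- The vertices that are not adjacent to all of `A`. -/
noncomputable def nonCommonNbrs [Fintype V] (G : SimpleGraph V) (A : Finset V) : Finset V :=
  open Classical in {x | ¬ ∀ a ∈ A, G.Adj x a}

@[simp]
theorem mem_nonCommonNbrs [Fintype V] {A : Finset V} {x : V} :
    x ∈ nonCommonNbrs G A ↔ ¬ ∀ a ∈ A, G.Adj x a := by
  simp [nonCommonNbrs]

theorem exists_card_mul_card_filter_le {W : Finset V} (hW : W.Nonempty) (S : V → V → Prop)
    [∀ x y, Decidable (S x y)] :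
    ∃ x ∈ W, #W * #{y ∈ W | S x y} ≤ #{p ∈ W ×ˢ W | S p.1 p.2} := by
  obtain ⟨x, hx, hmin⟩ := exists_min_image W (fun x => #{y ∈ W | S x y}) hW
  refine ⟨x, hx, (card_nsmul_le_sum W _ _ hmin).trans_eq ?_⟩
  simp only [card_filter, sum_product]

theorem nbhdIn_adj_of_le_codegIn {L : Finset V} {x y : V} (h : degIn G L x ≤ codegIn G L x y)
    {a : V} (ha : a ∈ nbhdIn G L x) : G.Adj y a := by
  classical
  rw [codegIn, degIn] at h
  exact filter_eq_self.1 (eq_of_subset_of_card_le (filter_subset _ _) h) a ha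

theorem exists_hub_set_of_codegIn [DecidableEq V] [Fintype V] {L W : Finset V} {t : ℕ}
    (hW : ∀ x ∈ W, degIn G L x ≤ t) (hlt : #{p ∈ W ×ˢ W | codegIn G L p.1 p.2 < t} < #W * #W) :
    ∃ A, #A = t ∧
      #W * #(nonCommonNbrs G A ∩ W) ≤ #{p ∈ W ×ˢ W | codegIn G L p.1 p.2 < t} := by
  have hWne : W.Nonempty := nonempty_of_ne_empty fun h => by simp [h] at hlt
  obtain ⟨x, hx, hfiber⟩ :=
    exists_card_mul_card_filter_le hWne fun x y => codegIn G L x y < t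
  obtain ⟨y, -, hxy⟩ : ∃ y ∈ W, t ≤ codegIn G L x y := by
    by_contra! hall
    rw [filter_true_of_mem hall] at hfiber
    exact absurd hlt hfiber.not_gt
  refine ⟨nbhdIn G L x, (hW x hx).antisymm (hxy.trans (codegIn_le_left ..)),
    (Nat.mul_le_mul_left _ (card_le_card fun z hz => ?_)).trans hfiber⟩
  rw [mem_inter, mem_nonCommonNbrs] at hz
  refine mem_filter.2 ⟨hz.2, ?_⟩
  by_contra! hxz
  exact hz.1 fun a ha => nbhdIn_adj_of_le_codegIn ((hW x hx).trans hxz) ha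

theorem card_adjPairs_le [Fintype V] {K : ℕ} (h : NoPath G (K + 1)) :
    #(adjPairs G) ≤ 2 * K * Fintype.card V :=
  card_adjPairs.trans_le (h.sum_degIn_le univ)

theorem card_exceptionalPairs_le [DecidableEq V] [Fintype V] {K m : ℕ} (h : NoPath G (K + 1))
    {L Z : Finset V} (hm : ∑ x ∈ Z, degIn G (L ∪ Z)ᶜ x ≤ m) :
    #(exceptionalPairs G L (L ∪ Z)ᶜ) ≤ 2 * K * #(L ∪ Z) + 2 * m := by
  classical
  set W := (L ∪ Z)ᶜ with hW
  have hadj : ∀ S S' : Finset V, #{p ∈ S ×ˢ S' | G.Adj p.1 p.2} = ∑ x ∈ S, degIn G S' x :=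
    fun S S' => by simp only [degIn, nbhdIn, card_filter, sum_product]
  have hcover : exceptionalPairs G L W ⊆ {p ∈ (L ∪ Z) ×ˢ (L ∪ Z) | G.Adj p.1 p.2} ∪
      ({p ∈ Z ×ˢ W | G.Adj p.1 p.2} ∪ {p ∈ W ×ˢ Z | G.Adj p.1 p.2}) := fun p hp => by
    obtain ⟨hp, hnot⟩ := mem_exceptionalPairs.1 hp
    simp only [hW, mem_union, mem_filter, mem_product, mem_compl, hp, and_true] at hnot ⊢
    tauto
  grw [hcover, card_union_le, card_union_le, hadj, hadj, hadj, sum_degIn_comm W Z,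
    h.sum_degIn_le (L ∪ Z), hm]
  lia

theorem card_codegIn_lt_le {L W : Finset V} {t : ℕ} (hW : ∀ x ∈ W, degIn G L x ≤ t) :
    #{p ∈ W ×ˢ W | codegIn G L p.1 p.2 < t} ≤
      #{p ∈ W ×ˢ W | degIn G L p.1 = t ∧ degIn G L p.2 = t ∧ codegIn G L p.1 p.2 < t} +
        2 * (#W * #{x ∈ W | degIn G L x < t}) := by
  classical
  set U := {x ∈ W | degIn G L x < t}
  have hcover : {p ∈ W ×ˢ W | codegIn G L p.1 p.2 < t} ⊆
      {p ∈ W ×ˢ W | degIn G L p.1 = t ∧ degIn G L p.2 = t ∧ codegIn G L p.1 p.2 < t} ∪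
        (W ×ˢ U ∪ U ×ˢ W) := fun p hp => by
    simp only [U, mem_union, mem_filter, mem_product] at hp ⊢
    have := hW p.1 hp.1.1
    have := hW p.2 hp.1.2
    simp only [hp, true_and, and_true]
    lia
  grw [hcover, card_union_le, card_union_le, card_product, card_product]
  lia

theorem card_fourPaths_add_card_codegIn_lt_le [DecidableEq V] [Fintype V] {t D : ℕ} (ht : 2 ≤ t)
    {L Z : Finset V} (h : ∀ x, ¬ Overfull G t L Z x)
    (hD : ∀ x ∈ (L ∪ Z)ᶜ, degIn G univ x ≤ D) :
    2 * #(fourPaths G) + #{p ∈ (L ∪ Z)ᶜ ×ˢ (L ∪ Z)ᶜ | codegIn G L p.1 p.2 < t} ≤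
      2 * (3 * t * (t - 1) * Fintype.card V ^ 2 + D ^ 2 * #(adjPairs G) +
        2 * (#(exceptionalPairs G L (L ∪ Z)ᶜ) * #(adjPairs G))) := by
  set W := (L ∪ Z)ᶜ
  have hcount := card_fourPaths_add_le (L := L) ht hD
  have hpairs : #{p ∈ W ×ˢ W | codegIn G L p.1 p.2 < t} ≤ _ :=
    card_codegIn_lt_le fun x hx => degIn_le_of_not_overfull h (mem_compl.1 hx)
  have hweight : #W * ∑ x ∈ W, (pairWeight (degIn G L x) + 2 * degIn G L x * degIn G W x) +
      #W * #{x ∈ W | degIn G L x < t} ≤ 3 * t * (t - 1) * Fintype.card V ^ 2 := by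
    have := sum_pairWeight_le (W := W) ht h disjoint_compl_left
    rw [sum_add_distrib, ← card_filter] at this
    calc _ = #W * (∑ x ∈ W, (pairWeight (degIn G L x) + 2 * degIn G L x * degIn G W x) +
          #{x ∈ W | degIn G L x < t}) := (mul_add ..).symm
      _ ≤ #W * (3 * t * (t - 1) * #W) := Nat.mul_le_mul_left _ this
      _ = 3 * t * (t - 1) * #W ^ 2 := by ring
      _ ≤ _ := by gcongr; exact card_le_univ W
  lia

theorem mul_card_filter_le_degIn_le [Fintype V] {K : ℕ} (h : NoPath G (K + 1)) (D : ℕ) :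
    D * #{x | D ≤ degIn G univ x} ≤ 2 * K * Fintype.card V :=
  calc D * #{x | D ≤ degIn G univ x} ≤ ∑ x with D ≤ degIn G univ x, degIn G univ x := by
        rw [mul_comm, ← smul_eq_mul]
        exact card_nsmul_le_sum _ _ _ fun x hx => (mem_filter.1 hx).2
    _ ≤ ∑ x, degIn G univ x := sum_le_sum_of_subset (subset_univ _)
    _ ≤ 2 * K * Fintype.card V := h.sum_degIn_le univ

theorem exists_cleaning_of_noPath {M : ℕ} (t : ℕ) (hM : 0 < M) :
    ∃ D : ℕ, ∀ (V : Type*) [DecidableEq V] [Fintype V] (G : SimpleGraph V),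
      M ≤ Fintype.card V → NoPath G (2 * t + 3) →
      ∃ L Z : Finset V, M * #(L ∪ Z) ≤ Fintype.card V ∧
        M * ∑ x ∈ Z, degIn G (L ∪ Z)ᶜ x ≤ Fintype.card V ∧
        (∀ x ∈ (L ∪ Z)ᶜ, degIn G univ x ≤ D) ∧ ∀ x, ¬ Overfull G t L Z x := by
  set K := 2 * t + 2
  set r := 4 * K * M with hr
  set c := (2 * t + 4) ^ (r + 1)
  set D := c * (2 * K) * M with hD
  refine ⟨D, fun V _ _ G hMn hno => ?_⟩
  set n := Fintype.card V
  set m := n / M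
  have hm : M * m ≤ n := Nat.mul_div_le n M
  have hnm : 2 * K * n ≤ r * m := by
    have hn : n < M * m + M := by
      have := Nat.lt_div_mul_add (a := n) hM
      rwa [mul_comm] at this
    have hm₁ : M * 1 ≤ M * m := Nat.mul_le_mul_left _ ((Nat.one_le_div_iff hM).2 hMn)
    calc 2 * K * n ≤ 2 * K * (2 * (M * m)) := by gcongr; lia
      _ = r * m := by rw [hr]; ring
  obtain ⟨L, Z, hheavy, hcard, hsparse, hclean⟩ :=
    exists_sparse_cleaning_set hno m r {x | D ≤ degIn G univ x} (hnm.trans' <|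
      (NoPath.sum_degIn_le (q := K) hno _).trans (Nat.mul_le_mul_left _ (card_le_univ _)))
  refine ⟨L, Z, ?_, (Nat.mul_le_mul_left _ hsparse).trans hm, fun x hx => ?_, hclean⟩
  · have hheavyCard := mul_card_filter_le_degIn_le (K := K) hno D
    have hK : 0 < 2 * K := by lia
    refine Nat.le_of_mul_le_mul_left ?_ hK
    calc 2 * K * (M * #(L ∪ Z)) ≤ 2 * K * (M * (c * #{x | D ≤ degIn G univ x})) := by gcongr
      _ = D * #{x | D ≤ degIn G univ x} := by rw [hD]; ring
      _ ≤ 2 * K * n := hheavyCard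
  · by_contra! hlt
    exact mem_compl.1 hx (mem_union_left _ (hheavy (mem_filter.2 ⟨mem_univ x, hlt.le⟩)))

theorem exists_hub_set_of_card_codegIn_lt_le [DecidableEq V] [Fintype V] {c t M : ℕ}
    (hc : 4 * c + 1 < M) (hV : 0 < Fintype.card V) {L U : Finset V}
    (hU : M * #U ≤ Fintype.card V) (hL : ∀ x ∈ Uᶜ, degIn G L x ≤ t)
    (hpairs : M * #{p ∈ Uᶜ ×ˢ Uᶜ | codegIn G L p.1 p.2 < t} ≤ c * Fintype.card V ^ 2) :
    ∃ A, #A = t ∧ M * #(nonCommonNbrs G A) ≤ (2 * c + 1) * Fintype.card V := by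
  set n := Fintype.card V
  set d := #{p ∈ Uᶜ ×ˢ Uᶜ | codegIn G L p.1 p.2 < t}
  have hcard : #Uᶜ + #U = n := card_compl_add_card U
  have hn : n ≤ 2 * #Uᶜ := by
    have := Nat.mul_le_mul_right #U (show 2 ≤ M by lia)
    lia
  have hd : d < #Uᶜ * #Uᶜ := by
    refine lt_of_mul_lt_mul_left (a := M) ?_ M.zero_le
    calc M * d ≤ c * n ^ 2 := hpairs
      _ ≤ c * (2 * #Uᶜ) ^ 2 := by gcongr
      _ = 4 * c * (#Uᶜ * #Uᶜ) := by ring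
      _ < M * (#Uᶜ * #Uᶜ) := by
        have : 0 < #Uᶜ := by lia
        gcongr
        lia
  obtain ⟨A, hA, hcommon⟩ := exists_hub_set_of_codegIn hL hd
  have hmissing : M * #(nonCommonNbrs G A ∩ Uᶜ) ≤ 2 * c * n := by
    refine Nat.le_of_mul_le_mul_left ?_ hV
    calc n * (M * #(nonCommonNbrs G A ∩ Uᶜ)) ≤ 2 * #Uᶜ * (M * #(nonCommonNbrs G A ∩ Uᶜ)) := by
          gcongr
      _ = 2 * (M * (#Uᶜ * #(nonCommonNbrs G A ∩ Uᶜ))) := by ring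
      _ ≤ 2 * (c * n ^ 2) := by grw [hcommon, hpairs]
      _ = n * (2 * c * n) := by ring
  have hsplit : #(nonCommonNbrs G A) ≤ #(nonCommonNbrs G A ∩ Uᶜ) + #U := by
    rw [← card_inter_add_card_sdiff (nonCommonNbrs G A) Uᶜ, sdiff_compl]
    gcongr
    exact inter_subset_right
  exact ⟨A, hA, by nlinarith⟩

theorem exists_hub_set {t M : ℕ} (ht : 2 ≤ t) (hM : 0 < M) :
    ∃ M' n₀ : ℕ, ∀ (V : Type*) [Fintype V] (G : SimpleGraph V),
      n₀ ≤ Fintype.card V → NoPath G (2 * t + 3) →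
      M' * (3 * t * (t - 1) * Fintype.card V ^ 2) ≤ M' * #(fourPaths G) + Fintype.card V ^ 2 →
      ∃ A : Finset V, #A = t ∧ M * #(nonCommonNbrs G A) ≤ Fintype.card V := by
  classical
  set K := 2 * t + 2
  set c := 4 + 16 * K * (K + 1) with hc
  set M' := (4 * c + 2) * M with hM'
  have hcM' : 4 * c + 1 < M' := by nlinarith
  obtain ⟨D, hclean⟩ := exists_cleaning_of_noPath (M := M') t (by lia)
  refine ⟨M', M' * (D ^ 2 * (2 * K)) + M', fun V _ G hn hno hmany => ?_⟩
  obtain ⟨L, Z, hLZ, hsparse, hD, hoverfull⟩ := hclean V G (by lia) hno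
  have hfew := Nat.mul_le_mul_left M' (card_fourPaths_add_card_codegIn_lt_le ht hoverfull hD)
  have hadj := card_adjPairs_le (K := K) hno
  have hexc := card_exceptionalPairs_le (K := K) hno (L := L) (Z := Z) le_rfl
  set n := Fintype.card V
  set W := (L ∪ Z)ᶜ
  replace hexc : M' * #(exceptionalPairs G L W) ≤ (2 * K + 2) * n := by
    have := Nat.mul_le_mul_left (2 * K) hLZ
    grw [hexc]
    linarith
  have hheavy : M' * (D ^ 2 * #(adjPairs G)) ≤ n ^ 2 :=
    calc M' * (D ^ 2 * #(adjPairs G)) ≤ M' * (D ^ 2 * (2 * K * n)) := by gcongr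
      _ = M' * (D ^ 2 * (2 * K)) * n := by ring
      _ ≤ n * n := by gcongr; lia
      _ = n ^ 2 := (sq n).symm
  have hexceptional : M' * (2 * (#(exceptionalPairs G L W) * #(adjPairs G))) ≤
      8 * K * (K + 1) * n ^ 2 :=
    calc M' * (2 * (#(exceptionalPairs G L W) * #(adjPairs G)))
        = 2 * (M' * #(exceptionalPairs G L W) * #(adjPairs G)) := by ring
      _ ≤ 2 * ((2 * K + 2) * n * (2 * K * n)) := by gcongr
      _ = 8 * K * (K + 1) * n ^ 2 := by ring
  obtain ⟨A, hA, hcommon⟩ := exists_hub_set_of_card_codegIn_lt_le hcM' (by lia) hLZ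
    (fun x hx => degIn_le_of_not_overfull hoverfull (mem_compl.1 hx))
    (show _ ≤ c * n ^ 2 by rw [hc]; linarith)
  exact ⟨A, hA, Nat.le_of_mul_le_mul_left (by nlinarith) (show 0 < 4 * c + 2 by lia)⟩

end Stability

section Structure

variable {V : Type*} {G : SimpleGraph V} {A B R : Finset V} {t : ℕ}

theorem exists_alternating_path {c : V} {as : List V} {S : Finset V}
    (hnodup : (c :: as).Nodup) (hB : ∀ b ∈ B, ∀ a ∈ c :: as, G.Adj b a)
    (hcard : #S + as.length ≤ #B) :
    ∃ l, IsPathList G (c :: l) ∧ (c :: l).getLast? = (c :: as).getLast? ∧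
      l.length = 2 * as.length ∧ ∀ v ∈ l, v ∈ as ∨ v ∈ B ∧ v ∉ S := by
  classical
  induction as generalizing c S with
  | nil => exact ⟨[], isPathList_singleton c, rfl, rfl, by simp⟩
  | cons d as ih =>
    have hdisj : ∀ a ∈ c :: d :: as, a ∉ B := fun a ha haB => G.irrefl (hB a haB a ha)
    rw [List.length_cons] at hcard
    obtain ⟨b, hbB, hbS⟩ := exists_mem_notMem_of_card_lt_card (show #S < #B by lia)
    obtain ⟨l, hl, hlast, hlen, hmem⟩ := ih (S := insert b S) hnodup.of_cons
      (fun b hb a ha => hB b hb a (List.mem_cons_of_mem _ ha)) (by grw [card_insert_le]; lia)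
    have hcas := (List.nodup_cons.1 hnodup).1
    have hmem' : ∀ v ∈ d :: l, v ∈ d :: as ∨ v ∈ B ∧ v ∉ insert b S := fun v hv => by
      rcases List.mem_cons.1 hv with rfl | hv
      · simp
      · exact (hmem v hv).imp_left (List.mem_cons_of_mem _)
    have hb : b ∉ d :: l := fun h => (hmem' b h).elim
      (fun h => hdisj b (List.mem_cons_of_mem _ h) hbB) fun h => h.2 (mem_insert_self b S)
    have hc : c ∉ b :: d :: l := by
      rw [List.mem_cons, not_or]
      refine ⟨?_, fun h => (hmem' c h).elim hcas fun h => hdisj c (by simp) h.1⟩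
      rintro rfl
      exact hdisj c (by simp) hbB
    refine ⟨b :: d :: l, (hl.cons (hB b hbB d (by simp)) hb).cons (hB b hbB c (by simp)).symm hc,
      by simpa using hlast, by simp [hlen]; lia, fun v hv => ?_⟩
    rcases List.mem_cons.1 hv with rfl | hv
    · exact .inr ⟨hbB, hbS⟩
    · exact (hmem' v hv).imp_right fun h => ⟨h.1, fun hS => h.2 (mem_insert_of_mem hS)⟩

theorem NoPath.length_add_length_le {m : ℕ} (h : NoPath G m) (hB : ∀ b ∈ B, ∀ a ∈ A, G.Adj b a)
    {p p' : List V} (hp : IsPathList G p) (hp' : IsPathList G p') (hdisj : p.Disjoint p')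
    (hpA : ∀ v ∈ p, v ∉ A) (hpA' : ∀ v ∈ p', v ∉ A) {a a' : V} (ha : a ∈ A) (ha' : a' ∈ A)
    (haa' : a ≠ a') (hadj : ∀ x ∈ p.head?, G.Adj a x) (hadj' : ∀ x ∈ p'.head?, G.Adj a' x)
    (hcard : p.length + p'.length + #A ≤ #B) :
    p.length + p'.length + 2 * #A ≤ m := by
  classical
  set as := ((A.erase a).erase a').toList ++ [a']
  have hmem : ∀ v, v ∈ a :: as ↔ v ∈ A := fun v => by
    simp only [as, List.mem_cons, List.mem_append, mem_toList, mem_erase, List.not_mem_nil]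
    grind
  have hnodup : (a :: as).Nodup := by
    simp only [as, List.nodup_cons, List.nodup_append, nodup_toList, List.mem_append, mem_toList,
      mem_erase, List.mem_singleton]
    grind
  have hlen : as.length + 1 = #A := by
    have h₁ := card_erase_add_one ha
    have h₂ := card_erase_add_one (mem_erase.2 ⟨haa'.symm, ha'⟩)
    simp only [as, List.length_append, length_toList, List.length_singleton]
    lia
  obtain ⟨l, hl, hlast, hllen, hlmem⟩ := exists_alternating_path (S := p.toFinset ∪ p'.toFinset)
    hnodup (fun b hb v hv => hB b hb v ((hmem v).1 hv))
    (by grw [card_union_le, List.toFinset_card_le, List.toFinset_card_le]; lia)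
  have hlmem' : ∀ v ∈ a :: l, v ∈ A ∨ v ∉ p ∧ v ∉ p' := fun v hv => by
    rcases List.mem_cons.1 hv with rfl | hv
    · exact .inl ha
    · refine (hlmem v hv).imp (fun hv => (hmem v).1 (List.mem_cons_of_mem _ hv)) fun hv => ?_
      simpa only [mem_union, List.mem_toFinset, not_or] using hv.2
  have hjoin : IsPathList G (p.reverse ++ ((a :: l) ++ p')) := by
    refine hp.reverse.append (hl.append hp' ?_ ?_) ?_ ?_
    · have hlast' : (a :: as).getLast? = some a' := by
        rw [← List.cons_append, List.getLast?_concat]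
      simpa [hlast, hlast'] using hadj'
    · intro v hv hv'
      exact (hlmem' v hv).elim (hpA' v hv') fun h => h.2 hv'
    · simpa [G.adj_comm] using hadj
    · intro v hv hv'
      rw [List.mem_reverse] at hv
      rcases List.mem_append.1 hv' with hv' | hv'
      · exact (hlmem' v hv').elim (hpA v hv) fun h => h.1 hv
      · exact hdisj hv hv'
  have := h _ hjoin
  simp only [List.length_append, List.length_reverse, List.length_cons] at this
  lia

theorem NoPath.length_add_one_le {m : ℕ} (h : NoPath G m) (hB : ∀ b ∈ B, ∀ a ∈ A, G.Adj b a)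
    (hA : 2 ≤ #A) {p : List V} (hp : IsPathList G p) (hpA : ∀ v ∈ p, v ∉ A) {a : V} (ha : a ∈ A)
    (hadj : ∀ x ∈ p.head?, G.Adj a x) (hcard : p.length + 1 + #A ≤ #B) :
    p.length + 1 + 2 * #A ≤ m := by
  classical
  obtain ⟨a', ha', haa'⟩ := exists_mem_ne (show 1 < #A by lia) a
  obtain ⟨b, hb, hbp⟩ := exists_mem_notMem_of_card_lt_card
    (show #p.toFinset < #B by grw [List.toFinset_card_le]; lia)
  rw [List.mem_toFinset] at hbp
  refine h.length_add_length_le hB hp (isPathList_singleton b) (by simpa) hpA ?_ ha ha'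
    haa'.symm hadj ?_ hcard
  · simpa using fun hbA => G.irrefl (hB b hb b hbA)
  · simpa using (hB b hb a' ha').symm

/-- The restrictions that a small set `A` with many common neighbours imposes on the edges inside
the remaining set `R`, when long paths are excluded: no path with three vertices in `R` starts at
a neighbour of `A`, and two disjoint edges in `R` are not joined to different vertices of `A`. -/
structure OuterEdges (G : SimpleGraph V) (A R : Finset V) : Prop where
  eq_of_adj : ∀ x ∈ R, ∀ y ∈ R, ∀ z ∈ R, 0 < degIn G A x → G.Adj x y → G.Adj y z → z = x
  not_disjoint : ∀ x ∈ R, ∀ y ∈ R, ∀ x' ∈ R, ∀ y' ∈ R, G.Adj x y → G.Adj x' y' →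
    ∀ a ∈ A, ∀ a' ∈ A, a ≠ a' → G.Adj a x → G.Adj a' x' → ¬ [x, y].Disjoint [x', y']

theorem NoPath.outerEdges [DecidableEq V] [Fintype V] (h : NoPath G (2 * #A + 3)) (hA : 2 ≤ #A)
    (hB : ∀ b ∈ B, ∀ a ∈ A, G.Adj b a) (hcard : #A + 4 ≤ #B) : OuterEdges G A Aᶜ where
  eq_of_adj x hx y hy z hz hxA hxy hyz := by
    by_contra hne
    rw [mem_compl] at hx hy hz
    obtain ⟨a, ha, hxa⟩ := degIn_pos_iff.1 hxA
    have hpath : IsPathList G [x, y, z] :=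
      (isPathList_pair hyz).cons hxy (by simp [hxy.ne, Ne.symm hne])
    have := h.length_add_one_le hB hA hpath (by simp [hx, hy, hz]) ha (by simpa using hxa.symm)
      (by simp; lia)
    simp only [List.length_cons, List.length_nil] at this
    lia
  not_disjoint x hx y hy x' hx' y' hy' hxy hxy' a ha a' ha' haa' hxa hxa' hdisj := by
    rw [mem_compl] at hx hy hx' hy'
    have := h.length_add_length_le hB (isPathList_pair hxy) (isPathList_pair hxy') hdisj
      (by simp [hx, hy]) (by simp [hx', hy']) ha ha' haa' (by simpa) (by simpa) (by simp; lia)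
    simp only [List.length_cons, List.length_nil] at this
    lia

/-- The vertices of `R` that have a neighbour in `R`. -/
noncomputable def nonIsolated (G : SimpleGraph V) (R : Finset V) : Finset V :=
  {x ∈ R | 0 < degIn G R x}

theorem mem_nonIsolated {x : V} : x ∈ nonIsolated G R ↔ x ∈ R ∧ ∃ y ∈ R, G.Adj x y := by
  simp only [nonIsolated, mem_filter, degIn_pos_iff]

theorem mem_nonIsolated_of_adj {x y : V} (hx : x ∈ R) (hy : y ∈ R) (hxy : G.Adj x y) :
    x ∈ nonIsolated G R :=
  mem_nonIsolated.2 ⟨hx, y, hy, hxy⟩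

theorem nonIsolated_subset : nonIsolated G R ⊆ R := filter_subset _ _

theorem OuterEdges.degIn_eq_one (h : OuterEdges G A R) {p q : V} (hp : p ∈ R) (hq : q ∈ R)
    (hpq : G.Adj p q) (hpA : 0 < degIn G A p) : degIn G R q = 1 := by
  refine card_eq_one.2 ⟨p, ?_⟩
  ext y
  rw [mem_nbhdIn, mem_singleton]
  refine ⟨fun ⟨hy, hqy⟩ => h.eq_of_adj p hp q hq y hy hpA hpq hqy, ?_⟩
  rintro rfl
  exact ⟨hp, hpq.symm⟩

/-- An edge of `R` whose ends both have neighbours in `A` is a component of `G` on `R`. -/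
theorem OuterEdges.disjoint_of_adj (h : OuterEdges G A R) {p q y y' : V} (hp : p ∈ R) (hq : q ∈ R)
    (hpq : G.Adj q p) (hpA : 0 < degIn G A p) (hqA : 0 < degIn G A q) (hy : y ∈ R)
    (hyq : y ≠ q) (hyp : y ≠ p) (hyy' : G.Adj y y') : [q, p].Disjoint [y, y'] := by
  have hy'q : y' ≠ q := by
    rintro rfl
    exact hyp (h.eq_of_adj p hp y' hq y hy hpA hpq.symm hyy'.symm)
  have hy'p : y' ≠ p := by
    rintro rfl
    exact hyq (h.eq_of_adj q hq y' hp y hy hqA hpq hyy'.symm)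
  simp [hyq, hyp, hy'q, hy'p]

theorem OuterEdges.card_inter_nonIsolated_le [DecidableEq V] (h : OuterEdges G A R) (hA : 2 ≤ #A)
    (hB : ∀ b ∈ B, ∀ a ∈ A, G.Adj b a) : #(B ∩ nonIsolated G R) ≤ 2 := by
  obtain ⟨a, ha, a', ha', haa'⟩ := one_lt_card.1 hA
  have hpos : ∀ b ∈ B, 0 < degIn G A b := fun b hb => degIn_pos_iff.2 ⟨a, ha, hB b hb a ha⟩
  obtain h₀ | ⟨x, hx⟩ := (B ∩ nonIsolated G R).eq_empty_or_nonempty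
  · simp [h₀]
  simp only [mem_inter, mem_nonIsolated] at hx
  obtain ⟨hxB, hxR, y, hyR, hxy⟩ := hx
  refine (card_le_card (t := {x, y}) fun x' hx' => ?_).trans card_le_two
  simp only [mem_inter, mem_nonIsolated] at hx'
  obtain ⟨hxB', hxR', y', hyR', hxy'⟩ := hx'
  by_contra hne
  simp only [mem_insert, mem_singleton, not_or] at hne
  refine h.not_disjoint x hxR y hyR x' hxR' y' hyR' hxy hxy' a ha a' ha' haa'
    (hB x hxB a ha).symm (hB x' hxB' a' ha').symm ?_
  have hy'x : y' ≠ x := by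
    rintro rfl
    exact hne.2 (h.eq_of_adj x' hxR' y' hxR y hyR (hpos x' hxB') hxy' hxy).symm
  have hy'y : y' ≠ y := by
    rintro rfl
    exact hne.1 (h.eq_of_adj x hxR y' hyR x' hxR' (hpos x hxB) hxy hxy'.symm)
  simp [hne.1, hne.2, hy'x, hy'y]

theorem OuterEdges.degIn_eq_zero (h : OuterEdges G A R) {p q y y' : V} (hp : p ∈ R) (hq : q ∈ R)
    (hpq : G.Adj q p) (hpA : 0 < degIn G A p) (hqA : 2 ≤ degIn G A q) (hy : y ∈ R)
    (hyq : y ≠ q) (hyp : y ≠ p) (hy' : y' ∈ R) (hyy' : G.Adj y y') : degIn G A y = 0 := by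
  by_contra hne
  obtain ⟨a', ha', hya'⟩ := degIn_pos_iff.1 (Nat.pos_of_ne_zero hne)
  obtain ⟨a, ha, haa'⟩ := exists_mem_ne (s := nbhdIn G A q) hqA a'
  rw [mem_nbhdIn] at ha
  exact h.not_disjoint q hq p hp y hy y' hy' hpq hyy' a ha.1 a' ha' haa' ha.2.symm hya'.symm
    (h.disjoint_of_adj hp hq hpq hpA (by lia) hy hyq hyp hyy')

theorem OuterEdges.sum_charge_le_of_adj (h : OuterEdges G A R) (hA : #A = t) (ht : 2 ≤ t)
    (hcard : 3 ≤ #(nonIsolated G R)) {p q : V} (hp : p ∈ R) (hq : q ∈ R) (hpq : G.Adj q p)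
    (hpA : 0 < degIn G A p) (hqA : 2 ≤ degIn G A q) :
    ∑ y ∈ nonIsolated G R, degIn G A y * (3 * (t - 1) + degIn G R y) + #(nonIsolated G R) ≤
      3 * t * (t - 1) * #(nonIsolated G R) := by
  classical
  set Y := nonIsolated G R
  have hne : ∀ {y}, y ∉ ({q, p} : Finset V) → y ≠ q ∧ y ≠ p := by simp
  have hsub : {q, p} ⊆ Y := by
    simp only [insert_subset_iff, singleton_subset_iff]
    exact ⟨mem_nonIsolated_of_adj hq hp hpq, mem_nonIsolated_of_adj hp hq hpq.symm⟩
  have hzero : ∀ y ∈ Y, y ∉ ({q, p} : Finset V) → degIn G A y = 0 := fun y hy hyn => by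
    obtain ⟨hyR, y', hy'R, hyy'⟩ := mem_nonIsolated.1 hy
    exact h.degIn_eq_zero hp hq hpq hpA hqA hyR (hne hyn).1 (hne hyn).2 hy'R hyy'
  have hfour : 4 ≤ #Y := by
    obtain ⟨y, hy, hyn⟩ := exists_mem_notMem_of_card_lt_card
      (show #({q, p} : Finset V) < #Y by rw [card_pair hpq.ne]; lia)
    obtain ⟨hyR, y', hy'R, hyy'⟩ := mem_nonIsolated.1 hy
    have hdisj := h.disjoint_of_adj hp hq hpq hpA (by lia) hyR (hne hyn).1 (hne hyn).2 hyy'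
    have hnodup : ([q, p] ++ [y, y']).Nodup := List.nodup_append'.2
      ⟨by simp [hpq.ne], by simp [hyy'.ne], hdisj⟩
    rw [← show #([q, p] ++ [y, y']).toFinset = 4 from List.toFinset_card_of_nodup hnodup]
    refine card_le_card fun z hz => ?_
    have hy' := mem_nonIsolated_of_adj hy'R hyR hyy'.symm
    simp only [insert_subset_iff, singleton_subset_iff] at hsub
    simp only [List.cons_append, List.nil_append, List.mem_toFinset, List.mem_cons,
      List.not_mem_nil, or_false] at hz
    rcases hz with rfl | rfl | rfl | rfl
    exacts [hsub.1, hsub.2, hy, hy']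
  rw [← sum_subset hsub fun y hy hyn => by rw [hzero y hy hyn, zero_mul], sum_pair hpq.ne,
    h.degIn_eq_one hp hq hpq.symm hpA, h.degIn_eq_one hq hp hpq (by lia)]
  have hqt : degIn G A q ≤ t := hA ▸ degIn_le_card A _
  have hpt : degIn G A p ≤ t := hA ▸ degIn_le_card A _
  obtain ⟨s, rfl⟩ := Nat.exists_eq_add_of_le ht
  rw [show 2 + s - 1 = s + 1 by lia]
  nlinarith [Nat.mul_le_mul (Nat.zero_le (s * s)) hfour]

theorem OuterEdges.charge_add_le (h : OuterEdges G A R) (hA : #A = t) (ht : 2 ≤ t)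
    (hedge : ∀ q ∈ R, ∀ p ∈ R, G.Adj q p → 0 < degIn G A p → degIn G A q ≤ 1) {q : V}
    (hq : q ∈ nonIsolated G R) :
    degIn G A q * (3 * (t - 1) + degIn G R q) + 1 +
        degIn G {y ∈ nonIsolated G R | ¬ 0 < degIn G A y} q ≤
      3 * t * (t - 1) +
        3 * t * (t - 1) * degIn G {y ∈ nonIsolated G R | ¬ 0 < degIn G A y} q := by
  obtain ⟨hqR, y, hyR, hqy⟩ := mem_nonIsolated.1 hq
  set Y₀ := {y ∈ nonIsolated G R | ¬ 0 < degIn G A y} with hY₀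
  have hqt : degIn G A q ≤ t := hA ▸ degIn_le_card A _
  obtain ⟨s, rfl⟩ := Nat.exists_eq_add_of_le ht
  rw [show 2 + s - 1 = s + 1 by lia]
  by_cases hp : ∃ p ∈ R, G.Adj q p ∧ 0 < degIn G A p
  · obtain ⟨p, hp, hqp, hpA⟩ := hp
    rw [h.degIn_eq_one hp hqR hqp.symm hpA]
    nlinarith [Nat.mul_le_mul_right (3 * (s + 1) + 1) (hedge q hqR p hp hqp hpA),
      Nat.zero_le ((3 * s * s + 9 * s) * degIn G Y₀ q)]
  · push Not at hp
    have hdeg : degIn G R q = degIn G Y₀ q := by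
      refine congrArg card (Finset.ext fun z => ?_)
      simp only [mem_nbhdIn, hY₀, mem_filter, mem_nonIsolated]
      exact ⟨fun hz => ⟨⟨⟨hz.1, q, hqR, hz.2.symm⟩, (hp z hz.1 hz.2).not_gt⟩, hz.2⟩,
        fun hz => ⟨hz.1.1.1, hz.2⟩⟩
    have hpos : 0 < degIn G Y₀ q := hdeg ▸ degIn_pos_iff.2 ⟨y, hyR, hqy⟩
    rw [hdeg]
    nlinarith [Nat.mul_le_mul_right (3 * (s + 1) + degIn G Y₀ q) hqt,
      Nat.mul_le_mul_left (3 * s * s + 8 * s + 3) hpos]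

/-- Vertices of `R` cost on average at most `3 * t * (t - 1) - 1`: a vertex adjacent to `A` may
cost more, but then it can pass the excess to its neighbours in `R`, which are not adjacent to `A`
and are not shared with other vertices adjacent to `A`. -/
theorem OuterEdges.sum_charge_le (h : OuterEdges G A R) (hA : #A = t) (ht : 2 ≤ t)
    (hcard : 3 ≤ #(nonIsolated G R)) :
    ∑ y ∈ nonIsolated G R, degIn G A y * (3 * (t - 1) + degIn G R y) + #(nonIsolated G R) ≤
      3 * t * (t - 1) * #(nonIsolated G R) := by
  by_cases hedge : ∃ q ∈ R, ∃ p ∈ R, G.Adj q p ∧ 0 < degIn G A p ∧ 2 ≤ degIn G A q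
  · obtain ⟨q, hq, p, hp, hqp, hpA, hqA⟩ := hedge
    exact h.sum_charge_le_of_adj hA ht hcard hp hq hqp hpA hqA
  push Not at hedge
  set Y := nonIsolated G R
  set Y₁ := {y ∈ Y | 0 < degIn G A y}
  set Y₀ := {y ∈ Y | ¬ 0 < degIn G A y}
  have hsplit : #Y₁ + #Y₀ = #Y := card_filter_add_card_filter_not _
  have hzero : ∑ y ∈ Y₀, degIn G A y * (3 * (t - 1) + degIn G R y) = 0 :=
    sum_eq_zero fun y hy => by
      rw [Nat.eq_zero_of_not_pos (mem_filter.1 hy).2, zero_mul]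
  have hcharge : ∑ q ∈ Y₁, degIn G A q * (3 * (t - 1) + degIn G R q) + #Y₁ +
      ∑ q ∈ Y₁, degIn G Y₀ q ≤ 3 * t * (t - 1) * #Y₁ +
        3 * t * (t - 1) * ∑ q ∈ Y₁, degIn G Y₀ q := by
    rw [card_eq_sum_ones, mul_sum, mul_sum, ← sum_add_distrib, ← sum_add_distrib,
      ← sum_add_distrib]
    refine sum_le_sum fun q hq => ?_
    rw [mul_one]
    exact h.charge_add_le hA ht (fun q hq p hp hqp hpA =>
      Nat.le_of_lt_succ (hedge q hq p hp hqp hpA)) (mem_filter.1 hq).1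
  have hshared : ∑ q ∈ Y₁, degIn G Y₀ q ≤ #Y₀ := by
    rw [sum_degIn_comm, card_eq_sum_ones]
    refine sum_le_sum fun y hy => card_le_one.2 fun q hq q' hq' => ?_
    rw [mem_nbhdIn, mem_filter] at hq hq'
    exact h.eq_of_adj q' (nonIsolated_subset hq'.1.1) y (nonIsolated_subset (mem_filter.1 hy).1) q
      (nonIsolated_subset hq.1.1) hq'.1.2 hq'.2.symm hq.2
  have hpos : 1 ≤ 3 * t * (t - 1) := Nat.mul_pos (by lia) (by lia)
  obtain ⟨c, hc⟩ := Nat.exists_eq_add_of_le hpos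
  rw [← sum_filter_add_sum_filter_not Y fun y => 0 < degIn G A y, hzero, add_zero]
  change ∑ q ∈ Y₁, _ + _ ≤ _
  rw [hc] at hcharge ⊢
  rw [← hsplit]
  nlinarith [Nat.mul_le_mul_left c hshared]

end Structure

section Comparison

variable {V : Type*} {G : SimpleGraph V} {A R Y : Finset V}

/-- The graph whose edges are all pairs that meet `A`. -/
def hubGraph (A : Finset V) : SimpleGraph V where
  Adj i j := i ≠ j ∧ (i ∈ A ∨ j ∈ A)
  symm := ⟨fun _ _ h => ⟨h.1.symm, h.2.symm⟩⟩
  loopless := ⟨fun _ h => h.1 rfl⟩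

theorem hubGraph_adj {i j : V} : (hubGraph A).Adj i j ↔ i ≠ j ∧ (i ∈ A ∨ j ∈ A) := Iff.rfl

theorem adj_cases [Fintype V] [DecidableEq V] {x y : V} (hxy : G.Adj x y) :
    x ∈ A ∨ y ∈ A ∨ x ∈ nonIsolated G Aᶜ ∧ y ∈ nonIsolated G Aᶜ := by
  by_contra! h
  rw [← mem_compl, ← mem_compl] at h
  exact h.2.2 (mem_nonIsolated_of_adj h.1 h.2.1 hxy) (mem_nonIsolated_of_adj h.2.1 h.1 hxy.symm)

theorem card_filter_ne_nbhdIn_product [DecidableEq V] (A : Finset V) (x : V) :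
    #{p ∈ nbhdIn G A x ×ˢ A | p.1 ≠ p.2} = degIn G A x * (#A - 1) := by
  have := card_filter_ne_product (nbhdIn G A x) A
  rw [inter_eq_left.2 (nbhdIn_subset A x)] at this
  rw [Nat.mul_sub, mul_one]
  lia

variable [Fintype V]

open Classical in
/-- The paths on four vertices that meet `Y`. -/
noncomputable def fourPathsThrough (G : SimpleGraph V) (Y : Finset V) : Finset (V × V × V × V) :=
  {p ∈ fourPaths G | p.1 ∈ Y ∨ p.2.1 ∈ Y ∨ p.2.2.1 ∈ Y ∨ p.2.2.2 ∈ Y}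

theorem mem_fourPathsThrough {x u v y : V} : (x, u, v, y) ∈ fourPathsThrough G Y ↔
    (x, u, v, y) ∈ fourPaths G ∧ (x ∈ Y ∨ u ∈ Y ∨ v ∈ Y ∨ y ∈ Y) := by
  simp [fourPathsThrough]

open Classical in
/-- The ordered pairs of adjacent vertices that meet `Y`. -/
noncomputable def adjPairsThrough (G : SimpleGraph V) (Y : Finset V) : Finset (V × V) :=
  {p ∈ adjPairs G | p.1 ∈ Y ∨ p.2 ∈ Y}

theorem mem_adjPairsThrough {p : V × V} :
    p ∈ adjPairsThrough G Y ↔ G.Adj p.1 p.2 ∧ (p.1 ∈ Y ∨ p.2 ∈ Y) := by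
  simp [adjPairsThrough]

theorem card_fourPathsIn_one_le (A R Y : Finset V) :
    #(fourPathsIn G R Y A univ) ≤
      Fintype.card V * ∑ q ∈ Y, degIn G A q * degIn G R q := by
  have hle : #(fourPathsIn G R Y A univ) ≤
      ∑ q ∈ Y, #((nbhdIn G A q ×ˢ nbhdIn G R q) ×ˢ (univ : Finset V)) := by
    refine card_le_sum_card (f := fun p => (p.2.1, (p.2.2.1, p.1), p.2.2.2))
      (fun _ _ => by simp +contextual [Prod.ext_iff]) ?_
    rintro ⟨x, u, v, y⟩ h
    rw [mem_fourPathsIn, mem_fourPaths] at h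
    simp [h, h.1.1.symm]
  simpa only [card_product, card_univ, ← sum_mul, mul_comm (Fintype.card V)] using hle

theorem NoPath.card_adjPairsThrough_le [DecidableEq V] {K : ℕ} (h : NoPath G (K + 1))
    (A : Finset V) :
    #(adjPairsThrough G (nonIsolated G Aᶜ)) ≤ 2 * K * (#A + #(nonIsolated G Aᶜ)) := by
  set Y := nonIsolated G Aᶜ
  refine le_trans ?_ ((h.sum_degIn_le (A ∪ Y)).trans (Nat.mul_le_mul_left _ (card_union_le A Y)))
  refine card_le_sum_card (f := id) Function.injective_id fun p hp => ?_
  rw [mem_adjPairsThrough] at hp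
  have hYA : ∀ x ∈ Y, x ∉ A := fun x hx => mem_compl.1 (nonIsolated_subset hx)
  have := adj_cases (A := A) hp.1
  have := hYA p.1
  have := hYA p.2
  simp only [id, mem_nbhdIn, mem_union]
  tauto

theorem card_fourPathsIn_two_le (A Y : Finset V) :
    #(fourPathsIn G Y A A univ) + #(fourPathsIn G Y A univ A) + #(fourPathsIn G A Y A univ) ≤
      Fintype.card V * ∑ q ∈ Y, degIn G A q * (3 * (#A - 1)) := by
  classical
  have hbound : ∀ (S : Finset (V × V × V × V)) (f : V × V × V × V → V × (V × V) × V),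
      f.Injective → (∀ p ∈ S, (f p).1 ∈ Y ∧ G.Adj (f p).1 (f p).2.1.1 ∧ (f p).2.1.1 ∈ A ∧
        (f p).2.1.2 ∈ A ∧ (f p).2.1.1 ≠ (f p).2.1.2) →
      #S ≤ ∑ q ∈ Y, degIn G A q * (#A - 1) * Fintype.card V := fun S f hf hS => by
    simp only [← card_filter_ne_nbhdIn_product, ← card_univ (α := V), ← card_product]
    refine card_le_sum_card hf fun p hp => ?_
    obtain ⟨hY, hadj, hA, hA', hne⟩ := hS p hp
    simp [hY, hadj, hA, hA', hne]
  refine (add_le_add (add_le_add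
    (hbound _ (fun p => (p.1, (p.2.1, p.2.2.1), p.2.2.2))
      (fun _ _ => by simp +contextual [Prod.ext_iff]) ?_)
    (hbound _ (fun p => (p.1, (p.2.1, p.2.2.2), p.2.2.1))
      (fun _ _ => by simp +contextual [Prod.ext_iff]) ?_))
    (hbound _ (fun p => (p.2.1, (p.1, p.2.2.1), p.2.2.2))
      (fun _ _ => by simp +contextual [Prod.ext_iff]) ?_)).trans_eq ?sum
  case sum =>
    simp only [mul_sum, ← sum_add_distrib]
    exact sum_congr rfl fun q _ => by ring
  all_goals
    rintro ⟨x, u, v, y⟩ h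
    rw [mem_fourPathsIn, mem_fourPaths] at h
    simp [h, h.1.1.symm, h.1.2.1.ne]

theorem fourPaths_cases_of_mem_nonIsolated [DecidableEq V] {x u v y : V}
    (hp : (x, u, v, y) ∈ fourPaths G) (hxuY : x ∈ nonIsolated G Aᶜ ∨ u ∈ nonIsolated G Aᶜ) :
    x ∈ nonIsolated G Aᶜ ∧ u ∈ A ∧ v ∈ A ∨ x ∈ nonIsolated G Aᶜ ∧ u ∈ A ∧ y ∈ A ∨
      x ∈ A ∧ u ∈ nonIsolated G Aᶜ ∧ v ∈ A ∨ x ∈ Aᶜ ∧ u ∈ nonIsolated G Aᶜ ∧ v ∈ A ∨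
        (x, u) ∈ adjPairsThrough G (nonIsolated G Aᶜ) ∧
          (y, v) ∈ A ×ˢ A ∪ adjPairsThrough G (nonIsolated G Aᶜ) := by
  obtain ⟨hxu, huv, hvy, -⟩ := mem_fourPaths.1 hp
  set Y := nonIsolated G Aᶜ
  have hYA : ∀ x ∈ Y, x ∉ A := fun x hx => mem_compl.1 (nonIsolated_subset hx)
  have hxu' := adj_cases (A := A) hxu
  have huv' := adj_cases (A := A) huv
  have hvy' := adj_cases (A := A) hvy
  simp only [mem_union, mem_product, mem_adjPairsThrough, hxu, hvy.symm, true_and, mem_compl]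
  grind

/-- A path that meets `Y` has, up to reversal, an end edge that meets `Y`. Its other end edge
contributes a factor of order `card V` only if it has exactly one vertex in `A`. -/
theorem card_fourPathsThrough_le [DecidableEq V] (A : Finset V) :
    #(fourPathsThrough G (nonIsolated G Aᶜ)) ≤ 2 * (Fintype.card V * ∑ q ∈ nonIsolated G Aᶜ,
      degIn G A q * (3 * (#A - 1) + degIn G Aᶜ q) + #(adjPairsThrough G (nonIsolated G Aᶜ)) *
        (#A ^ 2 + #(adjPairsThrough G (nonIsolated G Aᶜ)))) := by
  have hcases {x u v y} :=
    fourPaths_cases_of_mem_nonIsolated (G := G) (A := A) (x := x) (u := u) (v := v) (y := y)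
  set Y := nonIsolated G Aᶜ
  set E := adjPairsThrough G Y
  have hsub : fourPathsThrough G Y ⊆
      (((fourPathsIn G Y A A univ ∪ fourPathsIn G univ A A Y) ∪
        (fourPathsIn G Y A univ A ∪ fourPathsIn G A univ A Y)) ∪
        ((fourPathsIn G A Y A univ ∪ fourPathsIn G univ A Y A) ∪
        (fourPathsIn G Aᶜ Y A univ ∪ fourPathsIn G univ A Y Aᶜ))) ∪
        {p ∈ fourPaths G | (p.1, p.2.1) ∈ E ∧ (p.2.2.2, p.2.2.1) ∈ A ×ˢ A ∪ E ∨
          (p.2.2.2, p.2.2.1) ∈ E ∧ (p.1, p.2.1) ∈ A ×ˢ A ∪ E} := by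
    rintro ⟨x, u, v, y⟩ h
    obtain ⟨hp, hY⟩ := mem_fourPathsThrough.1 h
    have hends : (x ∈ Y ∨ u ∈ Y) ∨ y ∈ Y ∨ v ∈ Y := by tauto
    simp only [mem_union, mem_filter, mem_fourPathsIn, hp, mem_univ, true_and, and_true]
    rcases hends with hxu | hyv
    · rcases hcases hp hxu with h | h | h | h | h <;>
        simp only [h, true_and, and_true, true_or, or_true, ← mem_union]
    · rcases hcases (mem_fourPaths_reverse.1 hp) hyv with h | h | h | h | h <;>
        simp only [h, true_and, and_true, true_or, or_true, ← mem_union]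
  have htwo := card_fourPathsIn_two_le (G := G) A Y
  have hone := card_fourPathsIn_one_le (G := G) A Aᶜ Y
  have hends := card_filter_ends_le (fourPaths G) E (A ×ˢ A ∪ E)
  have hunion : #E * #(A ×ˢ A ∪ E) ≤ #E * (#A ^ 2 + #E) :=
    Nat.mul_le_mul_left _ ((card_union_le _ _).trans_eq (by rw [card_product, sq]))
  have hsum : Fintype.card V * ∑ q ∈ Y, degIn G A q * (3 * (#A - 1) + degIn G Aᶜ q) =
      Fintype.card V * ∑ q ∈ Y, degIn G A q * (3 * (#A - 1)) +
        Fintype.card V * ∑ q ∈ Y, degIn G A q * degIn G Aᶜ q := by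
    simp only [mul_add, sum_add_distrib]
  have hreverse := card_fourPathsIn_reverse (G := G)
  refine (card_le_card hsub).trans ?_
  grw [card_union_le, card_union_le, card_union_le, card_union_le, card_union_le, card_union_le,
    card_union_le, card_union_le, hends, hreverse univ A A Y, hreverse A univ A Y,
    hreverse univ A Y A, hreverse univ A Y Aᶜ, hunion, hsum]
  lia

theorem three_mul_le_card_hubGraph [DecidableEq V] {X : Finset V} (hX : Disjoint A X)
    (hY : Disjoint A Y) :
    3 * (#A * (#A - 1) * #{p ∈ X ×ˢ Y | p.1 ≠ p.2}) ≤
      #(fourPathsIn (hubGraph A) X A A Y ∪ (fourPathsIn (hubGraph A) X A Y A ∪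
        fourPathsIn (hubGraph A) A X A Y)) := by
  have hbound : ∀ (S : Finset (V × V × V × V)) (f : (V × V) × V × V → V × V × V × V),
      f.Injective → (∀ a ∈ A, ∀ a' ∈ A, a ≠ a' → ∀ x ∈ X, ∀ y ∈ Y, x ≠ y →
        f ((a, a'), x, y) ∈ S) → #A * (#A - 1) * #{p ∈ X ×ˢ Y | p.1 ≠ p.2} ≤ #S :=
    fun S f hf hS => by
      rw [Nat.mul_sub, mul_one, ← offDiag_card, ← card_product]
      refine card_le_card_of_injOn f (fun p hp => ?_) hf.injOn
      simp only [coe_product, Set.mem_prod, mem_coe, mem_offDiag, mem_filter, mem_product] at hp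
      exact hS _ hp.1.1 _ hp.1.2.1 hp.1.2.2 _ hp.2.1.1 _ hp.2.1.2 hp.2.2
  rw [disjoint_left] at hX hY
  calc 3 * (#A * (#A - 1) * #{p ∈ X ×ˢ Y | p.1 ≠ p.2}) = _ + (_ + _) := by
        rw [show 3 = 1 + (1 + 1) from rfl, add_mul, add_mul, one_mul]
    _ ≤ #(fourPathsIn (hubGraph A) X A A Y) +
          (#(fourPathsIn (hubGraph A) X A Y A) + #(fourPathsIn (hubGraph A) A X A Y)) :=
        add_le_add (hbound _ (fun p => (p.2.1, p.1.1, p.1.2, p.2.2))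
            (fun _ _ => by simp +contextual [Prod.ext_iff]) ?_) (add_le_add
          (hbound _ (fun p => (p.2.1, p.1.1, p.2.2, p.1.2))
            (fun _ _ => by simp +contextual [Prod.ext_iff]) ?_)
          (hbound _ (fun p => (p.1.1, p.2.1, p.1.2, p.2.2))
            (fun _ _ => by simp +contextual [Prod.ext_iff]) ?_))
    _ = _ := by
        rw [card_union_of_disjoint, card_union_of_disjoint] <;>
          rw [disjoint_left] <;>
          rintro ⟨x, u, v, y⟩ <;>
          simp only [mem_fourPathsIn, mem_union] <;>
          grind
  all_goals
    simp only [mem_fourPathsIn, mem_fourPaths, hubGraph_adj]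
    grind

theorem six_mul_le_card_fourPathsThrough_hubGraph {B : Finset V} (hAY : Disjoint A Y)
    (hAB : Disjoint A B) (hYB : Disjoint Y B) :
    6 * (#A * (#A - 1) * (#Y * #B)) ≤ #(fourPathsThrough (hubGraph A) Y) := by
  classical
  have hfilter : ∀ {X Z : Finset V}, Disjoint X Z → #{p ∈ X ×ˢ Z | p.1 ≠ p.2} = #X * #Z :=
    fun {X Z} hXZ => by
      have := card_filter_ne_product X Z
      rwa [disjoint_iff_inter_eq_empty.1 hXZ, card_empty, add_zero] at this
  have hYB' := three_mul_le_card_hubGraph hAY hAB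
  have hBY' := three_mul_le_card_hubGraph hAB hAY
  rw [hfilter hYB] at hYB'
  rw [hfilter hYB.symm, mul_comm #B] at hBY'
  calc 6 * (#A * (#A - 1) * (#Y * #B)) ≤ _ := by
        rw [show 6 = 3 + 3 from rfl, add_mul]
        exact add_le_add hYB' hBY'
    _ = _ := (card_union_of_disjoint ?_).symm
    _ ≤ _ := card_le_card ?_
  · rw [disjoint_left] at hAY hAB hYB ⊢
    rintro ⟨x, u, v, y⟩
    simp only [mem_fourPathsIn, mem_union]
    grind
  · rintro ⟨x, u, v, y⟩
    simp only [mem_fourPathsIn, mem_union, mem_fourPathsThrough]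
    tauto

theorem card_fourPaths_add_fourPathsThrough_le [DecidableEq V] (A : Finset V) :
    #(fourPaths G) + #(fourPathsThrough (hubGraph A) (nonIsolated G Aᶜ)) ≤
      #(fourPaths (hubGraph A)) + #(fourPathsThrough G (nonIsolated G Aᶜ)) := by
  set Y := nonIsolated G Aᶜ
  have hadj : ∀ {i j}, G.Adj i j → i ∉ Y → (hubGraph A).Adj i j := fun hij hi =>
    ⟨hij.ne, (adj_cases hij).imp_right fun h => h.resolve_right fun h => hi h.1⟩
  have hsub : fourPaths G \ fourPathsThrough G Y ⊆
      fourPaths (hubGraph A) \ fourPathsThrough (hubGraph A) Y := by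
    rintro ⟨x, u, v, y⟩ hp
    rw [Finset.mem_sdiff, mem_fourPathsThrough, mem_fourPaths] at hp
    obtain ⟨⟨hxu, huv, hvy, hne⟩, hpY⟩ := hp
    have hY : x ∉ Y ∧ u ∉ Y ∧ v ∉ Y := by
      refine ⟨fun h => hpY ?_, fun h => hpY ?_, fun h => hpY ?_⟩ <;>
        simp only [hxu, huv, hvy, hne, h, ne_eq, not_false_eq_true, true_and, true_or, or_true]
    rw [Finset.mem_sdiff, mem_fourPathsThrough, mem_fourPaths]
    exact ⟨⟨hadj hxu hY.1, hadj huv hY.2.1, hadj hvy hY.2.2, hne⟩,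
      fun h => hpY ⟨⟨hxu, huv, hvy, hne⟩, h.2⟩⟩
  have hle : ∀ H : SimpleGraph V, fourPathsThrough H Y ⊆ fourPaths H := fun H => by
    rintro ⟨x, u, v, y⟩ hp
    exact (mem_fourPathsThrough.1 hp).1
  have hG := card_sdiff_add_card_eq_card (hle G)
  have hH := card_sdiff_add_card_eq_card (hle (hubGraph A))
  have := card_le_card hsub
  lia

theorem card_fourPaths_lt_hubGraph [DecidableEq V] {t K : ℕ} (hA : #A = t) (h : NoPath G (K + 1))
    (hY : 0 < #(nonIsolated G Aᶜ))
    (hsum : ∑ q ∈ nonIsolated G Aᶜ, degIn G A q * (3 * (t - 1) + degIn G Aᶜ q) +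
      #(nonIsolated G Aᶜ) ≤ 3 * t * (t - 1) * #(nonIsolated G Aᶜ))
    (hn : 3 * t * (t - 1) * Fintype.card V + 2 * K * (t + 1) * t ^ 2 +
      (2 * K * (t + 1)) ^ 2 * #(nonIsolated G Aᶜ) <
        Fintype.card V + 3 * t * (t - 1) * #(Aᶜ \ nonIsolated G Aᶜ)) :
    #(fourPaths G) < #(fourPaths (hubGraph A)) := by
  have hpairs := h.card_adjPairsThrough_le A
  have hupper := card_fourPathsThrough_le (G := G) A
  have hadd := card_fourPaths_add_fourPathsThrough_le (G := G) A
  set Y := nonIsolated G Aᶜ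
  have hAY : Disjoint A Y := disjoint_compl_right.mono_right nonIsolated_subset
  have hlower := six_mul_le_card_fourPathsThrough_hubGraph hAY
    (disjoint_compl_right.mono_right (sdiff_subset (t := Y))) disjoint_sdiff
  rw [hA] at hpairs hupper hlower
  set S := ∑ q ∈ Y, degIn G A q * (3 * (t - 1) + degIn G Aᶜ q)
  set E := #(adjPairsThrough G Y)
  set B := Aᶜ \ Y
  set c := 2 * K * (t + 1) with hc
  suffices Fintype.card V * S + E * (t ^ 2 + E) < 3 * (t * (t - 1) * (#Y * #B)) by lia
  have hE : E ≤ c * #Y := hpairs.trans (by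
    rw [hc, mul_assoc (2 * K) (t + 1)]
    exact Nat.mul_le_mul_left _ (by nlinarith))
  refine lt_of_add_lt_add_right (a := Fintype.card V * #Y) ?_
  calc Fintype.card V * S + E * (t ^ 2 + E) + Fintype.card V * #Y
      = Fintype.card V * (S + #Y) + E * (t ^ 2 + E) := by ring
    _ ≤ Fintype.card V * (3 * t * (t - 1) * #Y) + c * #Y * (t ^ 2 + c * #Y) := by gcongr
    _ = (3 * t * (t - 1) * Fintype.card V + c * t ^ 2 + c ^ 2 * #Y) * #Y := by ring
    _ < (Fintype.card V + 3 * t * (t - 1) * #B) * #Y := by gcongr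
    _ = 3 * (t * (t - 1) * (#Y * #B)) + Fintype.card V * #Y := by ring

end Comparison

section Copies

open SimpleGraph

variable {V W : Type*} {G : SimpleGraph V} {H : SimpleGraph W}

theorem toSubgraph_eq_iff {f g : Copy H G} :
    g.toSubgraph = f.toSubgraph ↔ ∃ σ : H ≃g H, g = f.comp σ.toCopy := by
  constructor
  · intro h
    have hf : ∀ b, (f (f.isoToSubgraph.symm b) : V) = b := fun b =>
      congrArg Subtype.val (f.isoToSubgraph.apply_symm_apply b)
    refine ⟨(g.isoToSubgraph.trans ⟨.setCongr (congrArg Subgraph.verts h), ?_⟩).trans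
      f.isoToSubgraph.symm, Copy.ext fun i => (hf ⟨g i, h ▸ (g.isoToSubgraph i).2⟩).symm⟩
    simp [h]
  · rintro ⟨σ, rfl⟩
    refine Subgraph.ext ?_ ?_
    · ext v
      simpa using (σ.surjective.exists (p := fun i => f i = v)).symm
    · ext v w
      constructor
      · rintro ⟨i, j, hij, rfl, rfl⟩
        exact ⟨σ i, σ j, σ.map_adj_iff.2 hij, rfl, rfl⟩
      · rintro ⟨i, j, hij, rfl, rfl⟩
        exact ⟨σ.symm i, σ.symm j, σ.symm.map_adj_iff.2 hij, congrArg f (σ.apply_symm_apply i),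
          congrArg f (σ.apply_symm_apply j)⟩

theorem labelledCopyCount_eq_natCard [Fintype V] [Fintype W] :
    G.labelledCopyCount H = Nat.card (Copy H G) := by
  classical
  rw [labelledCopyCount, Nat.card_eq_fintype_card]

theorem labelledCopyCount_eq_mul_copyCount [Fintype V] [Fintype W] :
    G.labelledCopyCount H = Nat.card (H ≃g H) * G.copyCount H := by
  classical
  rw [labelledCopyCount, copyCount_eq_card_image_copyToSubgraph, ← card_univ,
    card_eq_sum_card_image Copy.toSubgraph, mul_comm, ← smul_eq_mul]
  refine sum_eq_card_nsmul fun S hS => ?_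
  obtain ⟨f, -, rfl⟩ := mem_image.1 hS
  rw [← Fintype.card_subtype, ← Nat.card_eq_fintype_card]
  refine (Nat.card_eq_of_bijective (fun σ => ⟨f.comp σ.toCopy, toSubgraph_eq_iff.2 ⟨σ, rfl⟩⟩)
    ⟨fun σ τ h => ?_, fun g => ?_⟩).symm
  · exact RelIso.ext fun i => f.injective (DFunLike.congr_fun (Subtype.ext_iff.1 h) i)
  · obtain ⟨σ, hσ⟩ := toSubgraph_eq_iff.1 g.2
    exact ⟨σ, Subtype.ext hσ.symm⟩

theorem card_iso_pathOfLength_three : Nat.card (pathOfLength 3 ≃g pathOfLength 3) = 2 := by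
  have hperm : ∀ e : Equiv.Perm (Fin 4),
      (∀ i j : Fin 4, i.1 + 1 = j.1 ∨ j.1 + 1 = i.1 → (e i).1 + 1 = (e j).1 ∨
        (e j).1 + 1 = (e i).1) → e = Equiv.refl _ ∨ e = Fin.revPerm := by decide
  have hrev : ∀ {i j : Fin 4}, (pathOfLength 3).Adj i.rev j.rev ↔ (pathOfLength 3).Adj i j := by
    simp only [pathGraph_adj]
    decide
  refine Nat.card_eq_two_iff.2 ⟨RelIso.refl _, ⟨Fin.revPerm, hrev⟩, fun h => ?_, ?_⟩
  · exact absurd (congrArg RelIso.toEquiv h) (by decide : Equiv.refl (Fin 4) ≠ Fin.revPerm)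
  · refine Set.eq_univ_of_forall fun σ => ?_
    refine (hperm σ.toEquiv fun i j hij => ?_).imp (fun h => ?_) fun h => ?_
    · exact pathGraph_adj.1 (σ.map_adj_iff.2 (pathGraph_adj.2 hij))
    all_goals exact RelIso.toEquiv_injective h

variable [Fintype V]

theorem isPathList_four {x u v y : V} :
    IsPathList G [x, u, v, y] ↔ (x, u, v, y) ∈ fourPaths G := by
  simp only [fourPaths, mem_filter, mem_univ, true_and]

theorem labelledCopyCount_eq_card_fourPaths :
    G.labelledCopyCount (pathOfLength 3) = #(fourPaths G) := by
  have hofFn (f : Copy (pathOfLength 3) G) : List.ofFn f = [f 0, f 1, f 2, f 3] := by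
    simp only [List.ofFn_succ, List.ofFn_zero]
    rfl
  rw [labelledCopyCount_eq_natCard, ← Fintype.card_coe, ← Nat.card_eq_fintype_card]
  refine Nat.card_eq_of_bijective
    (fun f => ⟨(f 0, f 1, f 2, f 3), isPathList_four.1 (hofFn f ▸ isPathList_ofFn f)⟩)
    ⟨fun f g h => Copy.ext fun i => ?_, ?_⟩
  · simp only [Subtype.mk.injEq, Prod.mk.injEq] at h
    fin_cases i
    exacts [h.1, h.2.1, h.2.2.1, h.2.2.2]
  · rintro ⟨⟨x, u, v, y⟩, h⟩
    obtain ⟨f, hf⟩ := (isPathList_four.2 h).exists_copy (m := 3) rfl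
    rw [hofFn] at hf
    exact ⟨f, Subtype.ext (by simpa only [List.cons.injEq, Prod.ext_iff, and_true] using hf)⟩

theorem two_mul_copyCount : 2 * G.copyCount (pathOfLength 3) = #(fourPaths G) := by
  rw [← labelledCopyCount_eq_card_fourPaths, labelledCopyCount_eq_mul_copyCount,
    card_iso_pathOfLength_three]

theorem card_fourPaths_le_of_copy {V' : Type*} [Fintype V'] {H : SimpleGraph V'} (f : Copy G H) :
    #(fourPaths G) ≤ #(fourPaths H) := by
  refine card_le_card_of_injOn (fun p => (f p.1, f p.2.1, f p.2.2.1, f p.2.2.2)) ?_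
    (Function.Injective.injOn fun p q h => ?_)
  · rintro ⟨x, u, v, y⟩ hp
    rw [mem_coe, mem_fourPaths] at hp ⊢
    obtain ⟨hxu, huv, hvy, hxv, hxy, huy⟩ := hp
    exact ⟨f.toHom.map_adj hxu, f.toHom.map_adj huv, f.toHom.map_adj hvy, f.injective.ne hxv,
      f.injective.ne hxy, f.injective.ne huy⟩
  · have hf : Function.Injective f := f.injective
    simpa only [Prod.ext_iff, hf.eq_iff] using h

theorem copyCount_pathOfLength_three_congr {V' : Type*} [Fintype V'] {H : SimpleGraph V'}
    (e : G ≃g H) : G.copyCount (pathOfLength 3) = H.copyCount (pathOfLength 3) := by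
  have hG := two_mul_copyCount (G := G)
  have hH := two_mul_copyCount (G := H)
  have hle := card_fourPaths_le_of_copy e.toCopy
  have hge := card_fourPaths_le_of_copy e.symm.toCopy
  lia

theorem eq_of_le_of_card_fourPaths_le {H : SimpleGraph V} (hle : G ≤ H)
    (hcard : #(fourPaths H) ≤ #(fourPaths G))
    (hH : ∀ i j, H.Adj i j → ∃ a b, (j, i, a, b) ∈ fourPaths H ∨ (a, j, i, b) ∈ fourPaths H) :
    G = H := by
  have hsub : fourPaths G ⊆ fourPaths H := by
    rintro ⟨x, u, v, y⟩ hp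
    rw [mem_fourPaths] at hp ⊢
    exact ⟨hle hp.1, hle hp.2.1, hle hp.2.2.1, hp.2.2.2⟩
  refine le_antisymm hle fun i j hij => ?_
  obtain ⟨a, b, h⟩ := hH i j hij
  rw [← eq_of_subset_of_card_le hsub hcard] at h
  simp only [mem_fourPaths] at h
  rcases h with h | h
  exacts [h.1.symm, h.2.1.symm]

end Copies

section HubPaths

variable {V : Type*} {G : SimpleGraph V} {A C D : Finset V}

theorem length_le_of_isChain [DecidableEq V]
    (hG : ∀ u v, G.Adj u v → u ∈ A ∨ v ∈ A ∨ u ∈ C ∧ v ∈ C) {l : List V} (hl : l.IsChain G.Adj) :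
    l.length ≤ 2 * l.countP (· ∈ A) + (l.countP (· ∈ C) - 1) +
      if ∃ x ∈ l.head?, x ∉ A then 1 else 0 := by
  induction l with
  | nil => simp
  | cons x l ih =>
    have ih := ih hl.tail
    have hC := (List.sublist_cons_self x l).countP_le (p := (· ∈ C))
    by_cases hx : x ∈ A
    · rw [List.countP_cons_of_pos (by simpa using hx), List.length_cons]
      split_ifs at ih <;> lia
    rw [List.countP_cons_of_neg (by simpa using hx), List.length_cons, if_pos ⟨x, rfl, hx⟩]
    obtain _ | ⟨y, l⟩ := l
    · simp
    by_cases hy : y ∈ A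
    · rw [if_neg (by simpa using hy)] at ih
      lia
    · have hxy := ((hG x y (List.isChain_cons_cons.1 hl).1).resolve_left hx).resolve_left hy
      rw [List.countP_cons_of_pos (p := (· ∈ C)) (by simpa using hxy.1)]
      have hpos : 0 < (y :: l).countP (· ∈ C) :=
        List.countP_pos_iff.2 ⟨y, List.mem_cons_self, by simpa using hxy.2⟩
      split_ifs at ih <;> lia

theorem noPath_of_forall_adj (hG : ∀ u v, G.Adj u v → u ∈ A ∨ v ∈ A ∨ u ∈ C ∧ v ∈ C)
    (hC : 0 < #C) : NoPath G (2 * #A + #C + 1) := by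
  classical
  intro l hl
  have hcount (S : Finset V) : l.countP (· ∈ S) ≤ #S := by
    rw [List.countP_eq_length_filter, ← List.toFinset_card_of_nodup (hl.nodup.filter _)]
    exact card_le_card fun x hx => by simpa using (List.mem_filter.1 (List.mem_toFinset.1 hx)).2
  have hlen := length_le_of_isChain hG hl.isChain
  have hlA := hcount A
  have hlC := hcount C
  split_ifs at hlen <;> lia

variable [Fintype V]

theorem le_card_fourPaths_hubGraph [DecidableEq V] (A : Finset V) :
    3 * (#A * (#A - 1) * (#Aᶜ * (#Aᶜ - 1))) ≤ #(fourPaths (hubGraph A)) := by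
  have hpairs := card_filter_ne_product Aᶜ Aᶜ
  rw [inter_self] at hpairs
  rw [show #Aᶜ * (#Aᶜ - 1) = #{p ∈ Aᶜ ×ˢ Aᶜ | p.1 ≠ p.2} by rw [Nat.mul_sub]; lia]
  refine (three_mul_le_card_hubGraph disjoint_compl_right disjoint_compl_right).trans
    (card_le_card ?_)
  rintro ⟨x, u, v, y⟩ hp
  simp only [mem_union, mem_fourPathsIn] at hp
  tauto

theorem mul_card_sq_le_card_fourPaths_hubGraph (A : Finset V) :
    3 * #A * (#A - 1) * Fintype.card V ^ 2 ≤
      #(fourPaths (hubGraph A)) + 3 * #A * (#A - 1) * (2 * #A + 1) * Fintype.card V := by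
  classical
  have hsq : Fintype.card V ^ 2 ≤ #Aᶜ * (#Aᶜ - 1) + (2 * #A + 1) * Fintype.card V := by
    rw [← card_add_card_compl A]
    obtain h | h := Nat.eq_zero_or_pos #Aᶜ
    · rw [h]
      nlinarith
    · obtain ⟨d, hd⟩ := Nat.exists_eq_add_of_lt h
      rw [hd, zero_add, Nat.add_sub_cancel]
      nlinarith
  calc 3 * #A * (#A - 1) * Fintype.card V ^ 2
      ≤ 3 * #A * (#A - 1) * (#Aᶜ * (#Aᶜ - 1) + (2 * #A + 1) * Fintype.card V) := by gcongr
    _ = 3 * (#A * (#A - 1) * (#Aᶜ * (#Aᶜ - 1))) +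
          3 * #A * (#A - 1) * (2 * #A + 1) * Fintype.card V := by ring
    _ ≤ _ := by grw [le_card_fourPaths_hubGraph A]

theorem card_fourPathsIn_middle_hub_le (A : Finset V) :
    #(fourPathsIn G univ A A univ) ≤ #A * (#A - 1) * Fintype.card V ^ 2 := by
  refine (card_le_sum_card (f := fun p => ((p.2.1, p.2.2.1), (p.1, p.2.2.2)))
    (I := A.offDiag) (B := fun _ => univ) (fun _ _ => by simp +contextual [Prod.ext_iff])
    ?_).trans_eq (by simp [offDiag_card, Nat.mul_sub, sq])
  rintro ⟨x, u, v, y⟩ hp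
  rw [mem_fourPathsIn, mem_fourPaths] at hp
  simp [hp, hp.1.2.1.ne]

theorem card_fourPathsIn_alternate_hub_le (A : Finset V) :
    #(fourPathsIn G A univ A univ) ≤ #A * (#A - 1) * Fintype.card V ^ 2 := by
  refine (card_le_sum_card (f := fun p => ((p.1, p.2.2.1), (p.2.1, p.2.2.2)))
    (I := A.offDiag) (B := fun _ => univ) (fun _ _ => by simp +contextual [Prod.ext_iff])
    ?_).trans_eq (by simp [offDiag_card, Nat.mul_sub, sq])
  rintro ⟨x, u, v, y⟩ hp
  rw [mem_fourPathsIn, mem_fourPaths] at hp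
  simp [hp]

theorem card_fourPathsIn_initial_le (D : Finset V) :
    #(fourPathsIn G D D D univ) ≤ #D ^ 3 * Fintype.card V := by
  refine (card_le_sum_card (f := fun p => ((p.1, p.2.1, p.2.2.1), p.2.2.2))
    (I := D ×ˢ D ×ˢ D) (B := fun _ => univ) (fun _ _ => by simp +contextual [Prod.ext_iff])
    ?_).trans_eq ?_
  · rintro ⟨x, u, v, y⟩ hp
    rw [mem_fourPathsIn] at hp
    simp [hp]
  · rw [sum_const, card_product, card_product, card_univ, smul_eq_mul]
    ring

theorem card_fourPaths_le_of_forall_adj (hAD : A ⊆ D)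
    (hG : ∀ u v, G.Adj u v → u ∈ A ∨ v ∈ A ∨ u ∈ D ∧ v ∈ D) :
    #(fourPaths G) ≤
      3 * #A * (#A - 1) * Fintype.card V ^ 2 + 2 * #D ^ 3 * Fintype.card V := by
  classical
  have hcover : fourPaths G ⊆ fourPathsIn G univ A A univ ∪ (fourPathsIn G A univ A univ ∪
      (fourPathsIn G univ A univ A ∪ (fourPathsIn G D D D univ ∪ fourPathsIn G univ D D D))) := by
    rintro ⟨x, u, v, y⟩ hp
    simp only [mem_union, mem_fourPathsIn, hp, mem_univ, true_and, and_true]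
    obtain ⟨hxu, huv, hvy, -⟩ := mem_fourPaths.1 hp
    by_cases hu : u ∈ A <;> by_cases hv : v ∈ A
    · exact .inl ⟨hu, hv⟩
    · obtain hy | ⟨hvD, hyD⟩ := (hG v y hvy).resolve_left hv
      exacts [.inr (.inr (.inl ⟨hu, hy⟩)), .inr (.inr (.inr (.inr ⟨hAD hu, hvD, hyD⟩)))]
    · obtain hx | hx | ⟨hxD, huD⟩ := hG x u hxu
      exacts [.inr (.inl ⟨hx, hv⟩), absurd hx hu, .inr (.inr (.inr (.inl ⟨hxD, huD, hAD hv⟩)))]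
    · obtain ⟨huD, hvD⟩ := ((hG u v huv).resolve_left hu).resolve_left hv
      obtain hx | hx | ⟨hxD, -⟩ := hG x u hxu
      exacts [.inr (.inr (.inr (.inl ⟨hAD hx, huD, hvD⟩))), absurd hx hu,
        .inr (.inr (.inr (.inl ⟨hxD, huD, hvD⟩)))]
  have hcard := card_le_card hcover
  grw [card_union_le, card_union_le, card_union_le, card_union_le,
    card_fourPathsIn_reverse univ A univ A, card_fourPathsIn_reverse univ D D D,
    card_fourPathsIn_middle_hub_le, card_fourPathsIn_alternate_hub_le,
    card_fourPathsIn_initial_le] at hcard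
  lia

theorem exists_mem_fourPaths_of_hubGraph_le (hle : hubGraph A ≤ G) (hA : 2 ≤ #A)
    (hV : 4 ≤ Fintype.card V) {i j : V} (hij : G.Adj i j) :
    ∃ a b, (j, i, a, b) ∈ fourPaths G ∨ (a, j, i, b) ∈ fourPaths G := by
  classical
  have hadj : ∀ a ∈ A, ∀ v, a ≠ v → G.Adj a v := fun a ha v hav => hle ⟨hav, .inl ha⟩
  have hfresh : ∀ x y z : V, ∃ b, b ≠ x ∧ b ≠ y ∧ b ≠ z := fun x y z => by
    obtain ⟨b, -, hb⟩ := exists_mem_notMem_of_card_lt_card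
      (show #({x, y, z} : Finset V) < #(univ : Finset V) by grw [card_le_three, card_univ]; lia)
    exact ⟨b, by simpa using hb⟩
  by_cases hhub : ∃ a ∈ A, a ≠ i ∧ a ≠ j
  · obtain ⟨a, ha, hai, haj⟩ := hhub
    obtain ⟨b, hbi, hbj, hba⟩ := hfresh i j a
    exact ⟨a, b, .inl (mem_fourPaths.2 ⟨hij.symm, (hadj a ha i hai).symm, hadj a ha b hba.symm,
      haj.symm, hbj.symm, hbi.symm⟩)⟩
  · have hsub : A ⊆ {i, j} := fun a ha => by
      by_contra h
      exact hhub ⟨a, ha, by simpa using h⟩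
    have hA_eq : A = {i, j} := eq_of_subset_of_card_le hsub (card_le_two.trans hA)
    obtain ⟨b, hbi, hbj, -⟩ := hfresh i j i
    obtain ⟨c, hci, hcj, hcb⟩ := hfresh i j b
    exact ⟨b, c, .inr (mem_fourPaths.2 ⟨(hadj j (by simp [hA_eq]) b hbj.symm).symm, hij.symm,
      hadj i (by simp [hA_eq]) c hci.symm, hbi, hcb.symm, hcj.symm⟩)⟩

end HubPaths

section ExtremalGraph

variable {n k t : ℕ} {A D : Finset (Fin n)}

/-- The first `t` vertices, which form the class `A` of `extGraph n k t`. -/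
def firstVertices (n t : ℕ) : Finset (Fin n) := {i | i.val < t}

theorem mem_firstVertices {i : Fin n} : i ∈ firstVertices n t ↔ i.val < t := by
  simp [firstVertices]

theorem card_firstVertices (h : t ≤ n) : #(firstVertices n t) = t := by
  rw [firstVertices, Fin.card_filter_val_lt, min_eq_right h]

theorem extGraph_adj {i j : Fin n} : (extGraph n k t).Adj i j ↔ i ≠ j ∧
    ((i ∈ firstVertices n (k - t) ∧ j ∈ firstVertices n (k - t)) ∨
      i ∈ firstVertices n t ∨ j ∈ firstVertices n t) := by
  simp only [mem_firstVertices]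
  rfl

theorem firstVertices_mono {s : ℕ} (h : s ≤ t) : firstVertices n s ⊆ firstVertices n t :=
  fun _ hi => mem_firstVertices.2 ((mem_firstVertices.1 hi).trans_le h)

theorem hubGraph_firstVertices_le : hubGraph (firstVertices n t) ≤ extGraph n k t :=
  fun _ _ h => extGraph_adj.2 ⟨h.1, .inr h.2⟩

theorem extGraph_noPath (hk : 2 * t < k) (hn : k ≤ n) : NoPath (extGraph n k t) (k + 1) := by
  have hcard : #(firstVertices n (k - t) \ firstVertices n t) = k - 2 * t := by
    rw [card_sdiff_of_subset (firstVertices_mono (by lia)), card_firstVertices (by lia),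
      card_firstVertices (by lia)]
    lia
  have := noPath_of_forall_adj (G := extGraph n k t) (A := firstVertices n t)
    (C := firstVertices n (k - t) \ firstVertices n t)
    (fun u v h => by simp only [Finset.mem_sdiff]; have := extGraph_adj.1 h; tauto) (by lia)
  rwa [hcard, card_firstVertices (by lia), show 2 * t + (k - 2 * t) = k by lia] at this

theorem exists_perm_forall_val_lt (hAD : A ⊆ D) : ∃ e : Equiv.Perm (Fin n),
    (∀ v ∈ A, (e v).val < #A) ∧ ∀ v ∈ D, (e v).val < #D := by
  set rank : Fin n → ℕ := fun v => if v ∈ A then 0 else if v ∈ D then 1 else 2 with hrank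
  have hlt (S : Finset (Fin n)) (r : ℕ) (hS : ∀ v, v ∈ S ↔ rank v ≤ r) :
      ∀ v ∈ S, ((Tuple.sort rank).symm v).val < #S := by
    intro v hv
    rw [← Nat.succ_le_iff, Nat.succ_eq_add_one, ← Fin.card_Iic]
    refine card_le_card_of_injOn (Tuple.sort rank) (fun i hi => (hS _).2 ?_)
      (Equiv.injective _).injOn
    have hmono := Tuple.monotone_sort rank (mem_Iic.1 (mem_coe.1 hi))
    simp only [Function.comp_apply, Equiv.apply_symm_apply] at hmono
    exact hmono.trans ((hS v).1 hv)
  refine ⟨(Tuple.sort rank).symm, hlt A 0 fun v => ?_, hlt D 1 fun v => ?_⟩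
  · simp only [hrank]
    split_ifs <;> simp_all
  · have := @hAD v
    simp only [hrank]
    split_ifs <;> simp_all

theorem exists_iso_le_extGraph {G : SimpleGraph (Fin n)} (hAD : A ⊆ D) (hA : #A ≤ t)
    (hD : #D ≤ k - t) (hG : ∀ u v, G.Adj u v → u ∈ A ∨ v ∈ A ∨ u ∈ D ∧ v ∈ D) :
    ∃ H ≤ extGraph n k t, Nonempty (G ≃g H) := by
  obtain ⟨e, heA, heD⟩ := exists_perm_forall_val_lt hAD
  refine ⟨G.map e, ?_, ⟨.map e G⟩⟩
  rintro _ _ ⟨hne, u, v, huv, rfl, rfl⟩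
  simp only [extGraph_adj, mem_firstVertices]
  refine ⟨hne, ?_⟩
  obtain hu | hv | ⟨hu, hv⟩ := hG u v huv
  · exact .inr (.inl ((heA u hu).trans_le hA))
  · exact .inr (.inr ((heA v hv).trans_le hA))
  · exact .inl ⟨(heD u hu).trans_le hD, (heD v hv).trans_le hD⟩

theorem card_fourPaths_hubGraph_le_extGraph (hA : #A ≤ t) (hk : 2 * t ≤ k) :
    #(fourPaths (hubGraph A)) ≤ #(fourPaths (extGraph n k t)) := by
  obtain ⟨H, hle, ⟨e⟩⟩ := exists_iso_le_extGraph (G := hubGraph A) (k := k) (t := t)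
    subset_rfl hA (by lia) fun u v h => by have := h.2; tauto
  exact card_fourPaths_le_of_copy ((SimpleGraph.Copy.ofLE _ _ hle).comp e.toCopy)

theorem nonempty_iso_extGraph {G : SimpleGraph (Fin n)} (ht : 2 ≤ t) (hn : 4 ≤ n) (htn : t ≤ n)
    (hAD : A ⊆ D) (hA : #A ≤ t) (hD : #D ≤ k - t)
    (hG : ∀ u v, G.Adj u v → u ∈ A ∨ v ∈ A ∨ u ∈ D ∧ v ∈ D)
    (hcard : #(fourPaths (extGraph n k t)) ≤ #(fourPaths G)) :
    Nonempty (G ≃g extGraph n k t) := by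
  obtain ⟨H, hle, ⟨e⟩⟩ := exists_iso_le_extGraph hAD hA hD hG
  obtain rfl : H = extGraph n k t := eq_of_le_of_card_fourPaths_le hle
    (hcard.trans (card_fourPaths_le_of_copy e.toCopy)) fun i j hij =>
      exists_mem_fourPaths_of_hubGraph_le hubGraph_firstVertices_le
        (by rwa [card_firstVertices htn]) (by rwa [Fintype.card_fin]) hij
  exact ⟨e⟩

end ExtremalGraph

section Extremal

variable {k t : ℕ}

section Charge

variable {V : Type*} {G : SimpleGraph V} {A B : Finset V}

theorem NoPath.degIn_eq_zero_of_adj (h : NoPath G (2 * #A + 2)) (hA : 2 ≤ #A)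
    (hB : ∀ b ∈ B, ∀ a ∈ A, G.Adj b a) (hcard : #A + 3 ≤ #B) {x y : V} (hx : x ∉ A)
    (hy : y ∉ A) (hxy : G.Adj x y) : degIn G A x = 0 := by
  by_contra hne
  obtain ⟨a, ha, hxa⟩ := degIn_pos_iff.1 (Nat.pos_of_ne_zero hne)
  have hlen := h.length_add_one_le hB hA (isPathList_pair hxy) (by simp [hx, hy]) ha
    (by simpa using hxa.symm) (by simp only [List.length_cons, List.length_nil]; lia)
  simp only [List.length_cons, List.length_nil] at hlen
  lia

variable [Fintype V] [DecidableEq V]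

theorem NoPath.sum_charge_le (ht : 2 ≤ t) (hk : k = 2 * t + 1 ∨ k = 2 * t + 2)
    (h : NoPath G (k + 1)) (hA : #A = t) (hB : ∀ b ∈ B, ∀ a ∈ A, G.Adj b a)
    (hcard : #A + 4 ≤ #B) (hY : k - 2 * t < #(nonIsolated G Aᶜ)) :
    ∑ q ∈ nonIsolated G Aᶜ, degIn G A q * (3 * (t - 1) + degIn G Aᶜ q) +
      #(nonIsolated G Aᶜ) ≤ 3 * t * (t - 1) * #(nonIsolated G Aᶜ) := by
  obtain rfl | rfl := hk
  · have hzero : ∀ q ∈ nonIsolated G Aᶜ, degIn G A q * (3 * (t - 1) + degIn G Aᶜ q) = 0 := by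
      intro q hq
      obtain ⟨hqA, r, hrA, hqr⟩ := mem_nonIsolated.1 hq
      rw [NoPath.degIn_eq_zero_of_adj (by rwa [hA]) (by lia) hB (by lia) (mem_compl.1 hqA)
        (mem_compl.1 hrA) hqr, zero_mul]
    rw [sum_eq_zero hzero, zero_add]
    exact Nat.le_mul_of_pos_left _ (Nat.mul_pos (by lia) (by lia))
  · exact (NoPath.outerEdges (by rwa [hA]) (by lia) hB hcard).sum_charge_le hA ht (by lia)

theorem NoPath.card_nonIsolated_le {M : ℕ} (ht : 2 ≤ t) (hk : k = 2 * t + 1 ∨ k = 2 * t + 2)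
    (h : NoPath G (k + 1)) (hA : #A = t)
    (hM : 2 * (3 * t * (t - 1) + (2 * (2 * t + 2) * (t + 1)) ^ 2) ≤ M)
    (hcommon : M * #(nonCommonNbrs G A) ≤ Fintype.card V)
    (hV : 2 * M + 2 * (2 * (2 * t + 2) * (t + 1) * t ^ 2) < Fintype.card V)
    (hcard : #(fourPaths (hubGraph A)) ≤ #(fourPaths G)) :
    #(nonIsolated G Aᶜ) ≤ k - 2 * t := by
  by_contra! hY
  set Y := nonIsolated G Aᶜ
  set B := (nonCommonNbrs G A)ᶜ
  set c := 2 * (2 * t + 2) * (t + 1) with hc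
  have h' : NoPath G (2 * t + 3) := h.mono (by lia)
  have hB : ∀ b ∈ B, ∀ a ∈ A, G.Adj b a := by simp [B]
  have hBcard : #(nonCommonNbrs G A) + #B = Fintype.card V := card_add_card_compl _
  have hBlarge : #A + 4 ≤ #B := by
    have : t + 4 ≤ c ^ 2 := by rw [hc]; nlinarith
    have hhalf : 2 * #(nonCommonNbrs G A) ≤ Fintype.card V :=
      (Nat.mul_le_mul_right _ (by lia)).trans hcommon
    lia
  have hO := NoPath.outerEdges (by rwa [hA]) (by lia) hB hBlarge
  have hAB : Disjoint A B := disjoint_left.2 fun a ha hb => (hB a hb a ha).ne rfl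
  have hBY : #(B ∩ Y) ≤ 2 := hO.card_inter_nonIsolated_le (by lia) hB
  have hZ : #B ≤ #(Aᶜ \ Y) + 2 := by
    have hsub : B ⊆ (Aᶜ \ Y) ∪ (B ∩ Y) := fun b hb => by
      by_cases hbY : b ∈ Y <;> simp [hb, hbY, disjoint_right.1 hAB hb]
    grw [card_le_card hsub, card_union_le, hBY]
  have hYZ : #Y + #(Aᶜ \ Y) ≤ Fintype.card V := by
    rw [← card_union_of_disjoint disjoint_sdiff]
    exact card_le_univ _
  refine absurd hcard (not_le.2 (card_fourPaths_lt_hubGraph hA h' (by lia)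
    (h.sum_charge_le ht hk hA hB hBlarge hY) ?_))
  set d := #(nonCommonNbrs G A)
  rw [← hc]
  nlinarith [Nat.zero_le d]

end Charge

theorem exists_forall_nonempty_iso_extGraph (ht : 2 ≤ t) (hk : k = 2 * t + 1 ∨ k = 2 * t + 2) :
    ∃ n₁ : ℕ, ∀ n, n₁ ≤ n → ∀ G : SimpleGraph (Fin n), NoPath G (k + 1) →
      #(fourPaths (extGraph n k t)) ≤ #(fourPaths G) → Nonempty (G ≃g extGraph n k t) := by
  classical
  set M := 2 * (3 * t * (t - 1) + (2 * (2 * t + 2) * (t + 1)) ^ 2)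
  obtain ⟨M', n₀, hhub⟩ := exists_hub_set (M := M) ht (by positivity)
  refine ⟨n₀ + M' * (3 * t * (t - 1) * (2 * t + 1)) +
    (2 * M + 2 * (2 * (2 * t + 2) * (t + 1) * t ^ 2)) + t + 4, fun n hn G hG hcard => ?_⟩
  have hlow := mul_card_sq_le_card_fourPaths_hubGraph (firstVertices n t)
  rw [card_firstVertices (by lia), Fintype.card_fin] at hlow
  grw [card_fourPaths_le_of_copy (.ofLE _ _ (hubGraph_firstVertices_le (k := k))), hcard] at hlow
  obtain ⟨A, hA, hcommon⟩ := hhub (Fin n) G (by rw [Fintype.card_fin]; lia)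
    (hG.mono (by lia)) (by
      rw [Fintype.card_fin]
      calc M' * (3 * t * (t - 1) * n ^ 2)
        _ ≤ M' * #(fourPaths G) + M' * (3 * t * (t - 1) * (2 * t + 1)) * n := by
          grw [hlow]
          exact (by ring : _ = _).le
        _ ≤ M' * #(fourPaths G) + n ^ 2 := by
          rw [sq]
          gcongr
          lia)
  have hY := hG.card_nonIsolated_le ht hk hA le_rfl hcommon (by rw [Fintype.card_fin]; lia)
    ((card_fourPaths_hubGraph_le_extGraph hA.le (by lia)).trans hcard)
  refine nonempty_iso_extGraph ht (by lia) (by lia) (subset_union_left (s₂ := nonIsolated G Aᶜ))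
    hA.le (by grw [card_union_le, hY]; lia) (fun u v huv => ?_) hcard
  obtain hu | hv | ⟨hu, hv⟩ := adj_cases (A := A) huv
  exacts [.inl hu, .inr (.inl hv), .inr (.inr ⟨mem_union_right _ hu, mem_union_right _ hv⟩)]

theorem ex_eq_and_isExtremalFor_iff (ht : 2 ≤ t) (hk : k = 2 * t + 1 ∨ k = 2 * t + 2) :
    ∃ n₁ : ℕ, ∀ n : ℕ, n₁ ≤ n →
      ex n (pathOfLength 3) (pathOfLength k) = (extGraph n k t).copyCount (pathOfLength 3) ∧
      ∀ G : SimpleGraph (Fin n),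
        IsExtremalFor G (pathOfLength 3) (pathOfLength k) ↔ Nonempty (G ≃g extGraph n k t) := by
  classical
  obtain ⟨n₁, hn₁⟩ := exists_forall_nonempty_iso_extGraph ht hk
  refine ⟨n₁ + k, fun n hn => ?_⟩
  have hfree : (pathOfLength k).Free (extGraph n k t) :=
    free_pathOfLength_iff.2 (extGraph_noPath (by lia) (by lia))
  have hiso : ∀ G : SimpleGraph (Fin n), (pathOfLength k).Free G →
      (extGraph n k t).copyCount (pathOfLength 3) ≤ G.copyCount (pathOfLength 3) →
      Nonempty (G ≃g extGraph n k t) := fun G hG hle =>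
    hn₁ n (by lia) G (free_pathOfLength_iff.1 hG) (by
      rw [← two_mul_copyCount, ← two_mul_copyCount]
      lia)
  have hex : ex n (pathOfLength 3) (pathOfLength k) =
      (extGraph n k t).copyCount (pathOfLength 3) := by
    unfold ex
    refine le_antisymm (Finset.sup_le fun G hG => ?_) ?_
    · by_contra! hlt
      obtain ⟨e⟩ := hiso G (mem_filter.1 hG).2 hlt.le
      exact hlt.ne' (copyCount_pathOfLength_three_congr e)
    · exact le_sup (f := fun G : SimpleGraph (Fin n) => G.copyCount (pathOfLength 3))
        (mem_filter.2 ⟨mem_univ _, hfree⟩)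
  refine ⟨hex, fun G => ⟨fun h => hiso G h.1 (hex.symm.trans h.2.symm).le, ?_⟩⟩
  rintro ⟨e⟩
  exact ⟨(SimpleGraph.free_congr_right e).2 hfree,
    (copyCount_pathOfLength_three_congr e).trans hex.symm⟩

theorem mul_sq_le_two_mul_copyCount_extGraph {n : ℕ} (hn : t ≤ n) :
    3 * t * (t - 1) * n ^ 2 ≤ 2 * (extGraph n k t).copyCount (pathOfLength 3) +
      3 * t * (t - 1) * (2 * t + 1) * n := by
  have hlow := mul_card_sq_le_card_fourPaths_hubGraph (firstVertices n t)
  rw [card_firstVertices hn, Fintype.card_fin] at hlow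
  grw [card_fourPaths_le_of_copy (.ofLE _ _ (hubGraph_firstVertices_le (k := k)))] at hlow
  rwa [two_mul_copyCount]

theorem two_mul_copyCount_extGraph_le {n : ℕ} (hk : 2 * t ≤ k) (hn : k ≤ n) :
    2 * (extGraph n k t).copyCount (pathOfLength 3) ≤
      3 * t * (t - 1) * n ^ 2 + 2 * (k - t) ^ 3 * n := by
  have hup := card_fourPaths_le_of_forall_adj (G := extGraph n k t)
    (firstVertices_mono (n := n) (show t ≤ k - t by lia)) fun u v h => by
      have := (extGraph_adj.1 h).2
      tauto
  rwa [card_firstVertices (by lia), card_firstVertices (by lia), Fintype.card_fin,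
    ← two_mul_copyCount] at hup

theorem ex_sub_isBigO (ht : 2 ≤ t) (hk : k = 2 * t + 1 ∨ k = 2 * t + 2) :
    (fun n : ℕ => (ex n (pathOfLength 3) (pathOfLength k) : ℝ) -
      3 * (t : ℝ) * ((t : ℝ) - 1) / 2 * (n : ℝ) ^ 2) =O[atTop] (fun n : ℕ => (n : ℝ)) := by
  obtain ⟨n₁, hn₁⟩ := ex_eq_and_isExtremalFor_iff ht hk
  refine IsBigO.of_bound ((3 * t * (t - 1) * (2 * t + 1) + 2 * (k - t : ℕ) ^ 3 : ℝ)) ?_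
  filter_upwards [eventually_ge_atTop (n₁ + k)] with n hn
  have hlow := mul_sq_le_two_mul_copyCount_extGraph (k := k) (t := t) (n := n) (by lia)
  have hup := two_mul_copyCount_extGraph_le (k := k) (t := t) (n := n) (by lia) (by lia)
  rw [← (hn₁ n (by lia)).1] at hlow hup
  have ht' : ((t - 1 : ℕ) : ℝ) = t - 1 := Nat.cast_pred (by lia)
  have ht₁ : (1 : ℝ) ≤ t := by exact_mod_cast (by lia : 1 ≤ t)
  rify at hlow hup
  rw [ht'] at hlow hup
  have hn₀ : (0 : ℝ) ≤ 3 * t * (t - 1) * (2 * t + 1) * n := by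
    have := sub_nonneg.2 ht₁
    positivity
  have hn₀' : (0 : ℝ) ≤ 2 * (k - t : ℕ) ^ 3 * n := by positivity
  rw [Real.norm_eq_abs, Real.norm_natCast, abs_le]
  constructor <;> linarith

end Extremal

end GenTuran

theorem mainTheorem10 (k t : ℕ) (hk : 5 ≤ k) (ht : t = (k - 1) / 2) :
    (∃ n₁ : ℕ, ∀ n : ℕ, n₁ ≤ n →
      GenTuran.ex n (GenTuran.pathOfLength 3) (GenTuran.pathOfLength k) =
        (GenTuran.extGraph n k t).copyCount (GenTuran.pathOfLength 3) ∧
      ∀ G : SimpleGraph (Fin n),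
        GenTuran.IsExtremalFor G (GenTuran.pathOfLength 3) (GenTuran.pathOfLength k) ↔
          Nonempty (G ≃g GenTuran.extGraph n k t)) ∧
    (fun n : ℕ =>
        (GenTuran.ex n (GenTuran.pathOfLength 3) (GenTuran.pathOfLength k) : ℝ) -
          3 * (t : ℝ) * ((t : ℝ) - 1) / 2 * (n : ℝ) ^ 2)
      =O[atTop] (fun n : ℕ => (n : ℝ)) :=
  ⟨GenTuran.ex_eq_and_isExtremalFor_iff (by lia) (by lia),
    GenTuran.ex_sub_isBigO (by lia) (by lia)⟩
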